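/- Let $2<\alpha<3$ and let $$D(\alpha)=\Big\{(z,w)\in\mathbb{C}^2:\ \big||w|^2-|z|^2\big|<(1+|z|^2+|w|^2)^{-\alpha}\Big\},$$ which is an unbounded Reinhardt domain in $\mathbb{C}^2$ (a connected open set invariant under $(z,w)\mapsto(\lambda z,\mu w)$ for $|\lambda|=|\mu|=1$). Let $A^2(D(\alpha))$ be its Bergman space, i.e. the space of holomorphic functions on $D(\alpha)$ that are square integrable with respect to Lebesgue measure, let $K=\sum_j|\varphi_j|^2$ be its Bergman kernel on the diagonal, for an orthonormal basis $(\varphi_j)$ of $A^2(D(\alpha))$, and put $g_{i\bar j}=\partial_i\partial_{\bar j}\log K$ (with $z_1=z$, $z_2=w$). Then: (i) $A^2(D(\alpha))=\mathrm{Span}_{\mathbb{C}}\{1,z,w\}$. (ii) The Bergman metric of $D(\alpha)$ is well defined, i.e. $K$ is smooth and positive and $(g_{i\bar j})$ is positive definite at every point of $D(\alpha)$, and it has constant holomorphic sectional curvature $2$: for every $p\in D(\alpha)$ and every $X\in\mathbb{C}^2\setminus\{0\}$, $$\frac{\sum_{i,j,k,l}R_{i\bar jk\bar l}(p)\,X_i\overline{X_j}X_k\overline{X_l}}{\big(\sum_{i,j}g_{i\bar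 j}(p)\,X_i\overline{X_j}\big)^2}=2,$$ where $R_{i\bar jk\bar l}=-\partial_k\partial_{\bar l}\,g_{i\bar j}+\sum_{a,b}g^{a\bar b}\,\partial_k g_{i\bar b}\,\partial_{\bar l}\,g_{a\bar j}$ and $\sum_b g^{a\bar b}g_{c\bar b}=\delta_{ac}$. -/

import Mathlib

open scoped ComplexOrder ContDiff ComplexConjugate
open TopologicalSpace MeasureTheory

noncomputable section

/-! ### The Bergman space, kernel and metric of an open set in `ℂⁿ` -/

section Bergman

variable {n : ℕ}

open Classical in
/-- Extension by zero to `ℂⁿ` of a function given on an open set `Ω`. -/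
def zeroExt (Ω : Opens (Fin n → ℂ)) (f : Ω → ℂ) (z : Fin n → ℂ) : ℂ :=
  if h : z ∈ Ω then f ⟨z, h⟩ else 0

theorem zeroExt_of_mem (Ω : Opens (Fin n → ℂ)) (f : Ω → ℂ) {z : Fin n → ℂ} (h : z ∈ Ω) :
    zeroExt Ω f z = f ⟨z, h⟩ := dif_pos h

theorem zeroExt_add (Ω : Opens (Fin n → ℂ)) (f g : Ω → ℂ) :
    zeroExt Ω (f + g) = zeroExt Ω f + zeroExt Ω g := by
  funext z
  by_cases h : z ∈ Ω <;> simp [zeroExt, h]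

theorem zeroExt_zero (Ω : Opens (Fin n → ℂ)) : zeroExt Ω (0 : Ω → ℂ) = 0 := by
  funext z
  by_cases h : z ∈ Ω <;> simp [zeroExt, h]

theorem zeroExt_smul (Ω : Opens (Fin n → ℂ)) (c : ℂ) (f : Ω → ℂ) :
    zeroExt Ω (c • f) = c • zeroExt Ω f := by
  funext z
  by_cases h : z ∈ Ω <;> simp [zeroExt, h]

/-- The Bergman space `A²(Ω)`: the holomorphic functions on `Ω` that are square integrable with
respect to Lebesgue measure. -/
def bergmanSpace (Ω : Opens (Fin n → ℂ)) : Submodule ℂ (Ω → ℂ) where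
  carrier := {f | DifferentiableOn ℂ (zeroExt Ω f) (Ω : Set (Fin n → ℂ)) ∧
    MemLp (zeroExt Ω f) 2 (volume.restrict (Ω : Set (Fin n → ℂ)))}
  add_mem' := by
    rintro f g ⟨hf, hf'⟩ ⟨hg, hg'⟩
    exact ⟨by rw [zeroExt_add]; exact hf.add hg, by rw [zeroExt_add]; exact hf'.add hg'⟩
  zero_mem' := by
    refine ⟨?_, ?_⟩
    · rw [zeroExt_zero]; exact differentiableOn_const 0
    · rw [zeroExt_zero]; exact MemLp.zero
  smul_mem' := by
    rintro c f ⟨hf, hf'⟩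
    exact ⟨by rw [zeroExt_smul]; exact hf.const_smul c,
      by rw [zeroExt_smul]; exact hf'.const_smul c⟩

/-- The inner product `(f, g) = ∫_Ω f ḡ dv` of the Bergman space. -/
def bergmanInner (Ω : Opens (Fin n → ℂ)) (f g : Ω → ℂ) : ℂ :=
  ∫ z in (Ω : Set (Fin n → ℂ)), zeroExt Ω f z * conj (zeroExt Ω g z)

/-- `S` is an orthonormal set in `A²(Ω)`. -/
structure IsBergmanOrthonormal (Ω : Opens (Fin n → ℂ)) (S : Set (Ω → ℂ)) : Prop where
  subset : S ⊆ (bergmanSpace Ω : Set (Ω → ℂ))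
  norm_one : ∀ f ∈ S, bergmanInner Ω f f = 1
  orthogonal : ∀ f ∈ S, ∀ g ∈ S, f ≠ g → bergmanInner Ω f g = 0

/-- `S` is an orthonormal basis of the Hilbert space `A²(Ω)`: an orthonormal set whose orthogonal
complement in `A²(Ω)` is trivial. -/
structure IsBergmanBasis (Ω : Opens (Fin n → ℂ)) (S : Set (Ω → ℂ)) : Prop
    extends IsBergmanOrthonormal Ω S where
  total : ∀ f ∈ bergmanSpace Ω, (∀ g ∈ S, bergmanInner Ω f g = 0) → f = 0

theorem bergmanInner_self (Ω : Opens (Fin n → ℂ)) (f : Ω → ℂ) :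
    bergmanInner Ω f f =
      ((∫ z in (Ω : Set (Fin n → ℂ)), ‖zeroExt Ω f z‖ ^ 2 : ℝ) : ℂ) := by
  rw [bergmanInner, ← integral_complex_ofReal]
  congr 1
  funext z
  rw [Complex.mul_conj, Complex.normSq_eq_norm_sq]

theorem bergmanInner_conj (Ω : Opens (Fin n → ℂ)) (f g : Ω → ℂ) :
    bergmanInner Ω g f = conj (bergmanInner Ω f g) := by
  rw [bergmanInner, bergmanInner, ← integral_conj]
  congr 1
  funext z
  simp [mul_comm]

theorem bergmanInner_smul_left (Ω : Opens (Fin n → ℂ)) (c : ℂ) (f g : Ω → ℂ) :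
    bergmanInner Ω (c • f) g = c * bergmanInner Ω f g := by
  rw [bergmanInner, bergmanInner, ← integral_const_mul]
  congr 1
  funext z
  simp [zeroExt_smul, mul_assoc]

theorem eq_zero_of_bergmanInner_self (Ω : Opens (Fin n → ℂ)) {f : Ω → ℂ}
    (hf : f ∈ bergmanSpace Ω) (h : bergmanInner Ω f f = 0) : f = 0 := by
  obtain ⟨hd, hL⟩ := hf
  rw [bergmanInner_self, Complex.ofReal_eq_zero,
    integral_eq_zero_iff_of_nonneg (fun _ => by positivity) (hL.integrable_norm_pow two_ne_zero)] at h
  have h0 : zeroExt Ω f =ᵐ[volume.restrict (Ω : Set (Fin n → ℂ))] (fun _ => 0) := by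
    filter_upwards [h] with z hz
    simpa using hz
  have := Measure.eqOn_open_of_ae_eq h0 Ω.isOpen hd.continuousOn continuousOn_const
  funext z
  have hz := this z.2
  rwa [zeroExt_of_mem Ω f z.2] at hz

theorem exists_isBergmanBasis (Ω : Opens (Fin n → ℂ)) : ∃ S, IsBergmanBasis Ω S := by
  obtain ⟨S, hS⟩ := zorn_subset {S : Set (Ω → ℂ) | IsBergmanOrthonormal Ω S} (by
    intro c hc hchain
    refine ⟨⋃₀ c, ⟨?_, ?_, ?_⟩, fun s hs => Set.subset_sUnion_of_mem hs⟩
    · exact Set.sUnion_subset fun s hs => (hc hs).subset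
    · rintro f ⟨s, hs, hf⟩
      exact (hc hs).norm_one f hf
    · rintro f ⟨s, hs, hf⟩ g ⟨t, ht, hg⟩ hne
      rcases hchain.total hs ht with h | h
      · exact (hc ht).orthogonal f (h hf) g hg hne
      · exact (hc hs).orthogonal f hf g (h hg) hne)
  have hO : IsBergmanOrthonormal Ω S := hS.prop
  refine ⟨S, hO, fun f hf hort => ?_⟩
  by_contra hne
  set r : ℝ := ∫ z in (Ω : Set (Fin n → ℂ)), ‖zeroExt Ω f z‖ ^ 2 with hr
  have hr0 : r ≠ 0 := fun h0 => hne (eq_zero_of_bergmanInner_self Ω hf (by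
    rw [bergmanInner_self, ← hr, h0, Complex.ofReal_zero]))
  have hrn : 0 ≤ r := integral_nonneg fun _ => by positivity
  set c : ℂ := (((Real.sqrt r)⁻¹ : ℝ) : ℂ) with hc
  have hcc : c * c * (r : ℂ) = 1 := by
    rw [hc]
    norm_cast
    rw [← mul_inv, Real.mul_self_sqrt hrn, inv_mul_cancel₀ hr0]
  have h1 : bergmanInner Ω (c • f) (c • f) = 1 := by
    rw [bergmanInner_smul_left, bergmanInner_conj, bergmanInner_smul_left, bergmanInner_self,
      ← hr, ← hcc, map_mul, Complex.conj_ofReal, hc, Complex.conj_ofReal, mul_assoc]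
  have h2 : ∀ g ∈ S, bergmanInner Ω (c • f) g = 0 := fun g hg => by
    rw [bergmanInner_smul_left, hort g hg, mul_zero]
  have hmem : c • f ∈ S := by
    have hins : IsBergmanOrthonormal Ω (insert (c • f) S) := by
      refine ⟨Set.insert_subset ((bergmanSpace Ω).smul_mem c hf) hO.subset, ?_, ?_⟩
      · rintro g (rfl | hg)
        · exact h1
        · exact hO.norm_one g hg
      · rintro g (rfl | hg) k (rfl | hk) hgk
        · exact absurd rfl hgk
        · exact h2 k hk
        · rw [bergmanInner_conj, h2 g hg, map_zero]
        · exact hO.orthogonal g hg k hk hgk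
    exact hS.le_of_ge hins (Set.subset_insert _ _) (Set.mem_insert _ _)
  rw [h2 _ hmem] at h1
  exact zero_ne_one h1

/-- An orthonormal basis of `A²(Ω)`. -/
def bergmanBasis (Ω : Opens (Fin n → ℂ)) : Set (Ω → ℂ) :=
  Classical.choose (exists_isBergmanBasis Ω)

theorem bergmanBasis_spec (Ω : Opens (Fin n → ℂ)) : IsBergmanBasis Ω (bergmanBasis Ω) :=
  Classical.choose_spec (exists_isBergmanBasis Ω)

/-- The Bergman kernel function on the diagonal, `K_Ω(z) = ∑ⱼ |φⱼ(z)|²` for an orthonormal basis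
`(φⱼ)` of `A²(Ω)`; it does not depend on the basis. -/
def bergmanKernel (Ω : Opens (Fin n → ℂ)) (z : Fin n → ℂ) : ℝ :=
  ∑' φ : bergmanBasis Ω, ‖zeroExt Ω (φ : Ω → ℂ) z‖ ^ 2

/-- The Wirtinger derivative `∂F/∂zⱼ = (∂F/∂xⱼ - i ∂F/∂yⱼ) / 2`. -/
def wirtinger (j : Fin n) (F : (Fin n → ℂ) → ℂ) (p : Fin n → ℂ) : ℂ :=
  (fderiv ℝ F p (Pi.single j 1) - Complex.I * fderiv ℝ F p (Pi.single j Complex.I)) / 2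

/-- The Wirtinger derivative `∂F/∂z̄ⱼ = (∂F/∂xⱼ + i ∂F/∂yⱼ) / 2`. -/
def wirtingerBar (j : Fin n) (F : (Fin n → ℂ) → ℂ) (p : Fin n → ℂ) : ℂ :=
  (fderiv ℝ F p (Pi.single j 1) + Complex.I * fderiv ℝ F p (Pi.single j Complex.I)) / 2

/-- The coefficients `g_{i j̄} = ∂² log K_Ω / ∂zᵢ ∂z̄ⱼ` of the Bergman form. -/
def bergmanMetric (Ω : Opens (Fin n → ℂ)) (p : Fin n → ℂ) : Matrix (Fin n) (Fin n) ℂ :=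
  Matrix.of fun i j =>
    wirtinger i (wirtingerBar j fun z => (Real.log (bergmanKernel Ω z) : ℂ)) p

/-- The Bergman metric of `Ω` is well defined: the kernel is smooth and positive on `Ω`
(`A²(Ω)` is base point free), and the Bergman form is positive definite on `Ω`. -/
structure HasBergmanMetric (Ω : Opens (Fin n → ℂ)) : Prop where
  smooth : ContDiffOn ℝ ∞ (bergmanKernel Ω) (Ω : Set (Fin n → ℂ))
  pos : ∀ p ∈ Ω, 0 < bergmanKernel Ω p
  posDef : ∀ p ∈ Ω, (bergmanMetric Ω p).PosDef

/-- The curvature tensor of a Hermitian (Kähler) metric `g` in coordinates,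
`R_{i j̄ k l̄} = -∂ₖ∂̄ₗ g_{i j̄} + ∑_{a,b} g^{a b̄} ∂ₖ g_{i b̄} ∂̄ₗ g_{a j̄}`,
where `∑_b g^{a b̄} g_{c b̄} = δ_{ac}`. -/
def kahlerCurvature (g : (Fin n → ℂ) → Matrix (Fin n) (Fin n) ℂ) (p : Fin n → ℂ)
    (i j k l : Fin n) : ℂ :=
  -wirtinger k (wirtingerBar l fun z => g z i j) p +
    ∑ a, ∑ b, (g p)⁻¹ b a * wirtinger k (fun z => g z i b) p * wirtingerBar l (fun z => g z a j) p

/-- The holomorphic sectional curvature `R(X, X̄, X, X̄) / g(X, X̄)²` of the Kähler metric `g` at `p`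
in the direction `X = ∑ᵢ Xᵢ ∂/∂zᵢ`. -/
def holSectionalCurvature (g : (Fin n → ℂ) → Matrix (Fin n) (Fin n) ℂ) (p X : Fin n → ℂ) : ℂ :=
  (∑ i, ∑ j, ∑ k, ∑ l, kahlerCurvature g p i j k l * X i * conj (X j) * X k * conj (X l)) /
    (∑ i, ∑ j, g p i j * X i * conj (X j)) ^ 2

/-- `Ω` is a Reinhardt set: it is invariant under the rotations `(zⱼ) ↦ (λⱼ zⱼ)`, `|λⱼ| = 1`. -/
def IsReinhardt (Ω : Opens (Fin n → ℂ)) : Prop :=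
  ∀ z ∈ Ω, ∀ c : Fin n → ℂ, (∀ j, ‖c j‖ = 1) → c * z ∈ Ω

end Bergman

/-- The set `D(α) = {(z, w) ∈ ℂ² : | |w|² - |z|² | < (1 + |z|² + |w|²)^(-α)}`, with `z = p 0` and
`w = p 1`. -/
def reinhardtD (α : ℝ) : Opens (Fin 2 → ℂ) where
  carrier := {p | |‖p 1‖ ^ 2 - ‖p 0‖ ^ 2| < (1 + ‖p 0‖ ^ 2 + ‖p 1‖ ^ 2) ^ (-α)}
  is_open' := by
    refine isOpen_lt (by fun_prop) (Continuous.rpow_const (by fun_prop) fun p => Or.inl ?_)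
    positivity

end

noncomputable section

/-! ### Rotations of `ℂⁿ` and circle means -/

/-! `D(α)` is a thin neighbourhood of the cone `|z| = |w|`: for large `|z|` its slice over `z` is an
annulus in `w` of area of order `|z|^(-2α)`. A monomial of degree `k` therefore has square norm
comparable at infinity to `∫ r^(2k+1-2α) dr`, which is finite exactly when `k < α - 1`. For `2 < α <
3` this admits degrees 0 and 1 only (`lintegral_one_add_norm_sq_lt_top`,
`lintegral_norm_pow_four_eq_top`).

To pass from monomials to arbitrary `F ∈ A²`, average over rotations. A Taylor coefficient is
bounded by a circle mean of `|F|`, so by Cauchy–Schwarz and rotation invariance each homogeneous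
part of `F`, and then each monomial in it, has `L²` norm at most that of `F`
(`lintegral_sq_le_of_le_circle_mean`). In degree at least 2 these norms would be infinite, so the
coefficients vanish (`homogeneousPart_eq_zero`) and `F` is affine.

The functions `1, z, w` are orthogonal by symmetry, so `K = c₀ + c₁|z|² + c₂|w|²` with positive
constants (`exists_bergmanKernel_reinhardtD`); their values are irrelevant. Up to a linear change of
coordinates `log K` is the Fubini–Study potential, for which `R_{i j̄ k l̄} = g_{i j̄} g_{k l̄} +
g_{k j̄} g_{i l̄}` (`kahlerCurvature_fubiniStudy`). Contracting with `X` gives `2 g(X, X̄)²`. -/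

theorem volume_preserving_mul_left_of_norm_eq_one {n : ℕ} {c : Fin n → ℂ} (hc : ∀ j, ‖c j‖ = 1) :
    MeasurePreserving (fun p : Fin n → ℂ => c * p) volume volume := by
  refine volume_preserving_pi (f := fun j z => c j * z) fun j => ?_
  have h := (rotation ⟨c j, by simp [Submonoid.unitSphere, hc j]⟩).measurePreserving
  exact h

theorem sq_lintegral_le {X : Type*} [MeasurableSpace X] (μ : Measure X) {g : X → ENNReal}
    (hg : AEMeasurable g μ) : (∫⁻ x, g x ∂μ) ^ 2 ≤ μ Set.univ * ∫⁻ x, g x ^ 2 ∂μ := by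
  have h := ENNReal.lintegral_mul_le_Lp_mul_Lq μ Real.HolderConjugate.two_two hg
    (aemeasurable_const (b := (1 : ENNReal)))
  simp only [Pi.mul_apply, mul_one, ENNReal.one_rpow, lintegral_const, one_mul] at h
  calc (∫⁻ x, g x ∂μ) ^ 2
      ≤ ((∫⁻ x, g x ^ (2 : ℝ) ∂μ) ^ (1 / 2 : ℝ) * μ Set.univ ^ (1 / 2 : ℝ)) ^ 2 := by gcongr
    _ = μ Set.univ * ∫⁻ x, g x ^ 2 ∂μ := by
      rw [mul_pow, ← ENNReal.rpow_natCast, ← ENNReal.rpow_mul, ← ENNReal.rpow_natCast,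
        ← ENNReal.rpow_mul]
      simp [mul_comm]

/-- A function dominated by the circle means of `F` along a family of rotations preserving `Ω` has
`L²` norm at most that of `F`. -/
theorem lintegral_sq_le_of_le_circle_mean {n : ℕ} {Ω : Set (Fin n → ℂ)} (hΩ : MeasurableSet Ω)
    {c : ℝ → Fin n → ℂ} (hcm : Continuous c) (hc : ∀ θ j, ‖c θ j‖ = 1)
    (hinv : ∀ θ p, c θ * p ∈ Ω ↔ p ∈ Ω) {F G : (Fin n → ℂ) → ℂ} (hF : Measurable F)
    (h : ∀ᵐ p, p ∈ Ω → ‖G p‖ ≤ (2 * Real.pi)⁻¹ * ∫ θ in (0 : ℝ)..2 * Real.pi, ‖F (c θ * p)‖) :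
    ∫⁻ p in Ω, ‖G p‖ₑ ^ 2 ≤ ∫⁻ p in Ω, ‖F p‖ₑ ^ 2 := by
  set ν : Measure ℝ := volume.restrict (Set.Ioc 0 (2 * Real.pi)) with hν
  have hpi : (0 : ℝ) ≤ 2 * Real.pi := by positivity
  have hνu : ν Set.univ = ENNReal.ofReal (2 * Real.pi) := by simp [hν]
  have hFc : Measurable fun x : (Fin n → ℂ) × ℝ => F (c x.2 * x.1) :=
    hF.comp (by fun_prop)
  set k : ENNReal := ENNReal.ofReal (2 * Real.pi) with hk
  have hk0 : k ≠ 0 := by simp [hk, Real.pi_pos]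
  have hkt : k ≠ ⊤ := ENNReal.ofReal_ne_top
  -- Jensen's inequality on the circle: the square of the mean is at most the mean of the square.
  have h1 : ∀ᵐ p ∂volume.restrict Ω, ‖G p‖ₑ ^ 2 ≤ k⁻¹ * ∫⁻ θ, ‖F (c θ * p)‖ₑ ^ 2 ∂ν := by
    rw [ae_restrict_iff' hΩ]
    filter_upwards [h] with p hp hpΩ
    have hm : Measurable fun θ => ‖F (c θ * p)‖ₑ := (hFc.comp (measurable_prodMk_left)).enorm
    have h2 : ‖G p‖ₑ ≤ k⁻¹ * ∫⁻ θ, ‖F (c θ * p)‖ₑ ∂ν := by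
      calc ‖G p‖ₑ ≤ ‖(2 * Real.pi)⁻¹ * ∫ θ in (0 : ℝ)..2 * Real.pi, ‖F (c θ * p)‖‖ₑ := by
            rw [← ofReal_norm, ← ofReal_norm]
            exact ENNReal.ofReal_le_ofReal ((hp hpΩ).trans (le_abs_self _))
        _ ≤ k⁻¹ * ∫⁻ θ, ‖F (c θ * p)‖ₑ ∂ν := by
            rw [enorm_mul, intervalIntegral.integral_of_le hpi]
            gcongr
            · rw [hk, ← ENNReal.ofReal_inv_of_pos (by positivity), Real.enorm_eq_ofReal (by positivity)]
            · refine (enorm_integral_le_lintegral_enorm _).trans (le_of_eq ?_)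
              simp [hν]
    calc ‖G p‖ₑ ^ 2 ≤ (k⁻¹ * ∫⁻ θ, ‖F (c θ * p)‖ₑ ∂ν) ^ 2 := by gcongr
      _ ≤ k⁻¹ ^ 2 * (k * ∫⁻ θ, ‖F (c θ * p)‖ₑ ^ 2 ∂ν) := by
          rw [mul_pow]
          gcongr
          exact (sq_lintegral_le ν hm.aemeasurable).trans (by rw [hνu])
      _ = k⁻¹ * ∫⁻ θ, ‖F (c θ * p)‖ₑ ^ 2 ∂ν := by
          rw [sq, ← mul_assoc, mul_assoc k⁻¹, ENNReal.inv_mul_cancel hk0 hkt, mul_one]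
  have h3 : ∀ θ, ∫⁻ p in Ω, ‖F (c θ * p)‖ₑ ^ 2 = ∫⁻ p in Ω, ‖F p‖ₑ ^ 2 := by
    intro θ
    have hpre : (fun p : Fin n → ℂ => c θ * p) ⁻¹' Ω = Ω := by
      ext p; exact hinv θ p
    have := (volume_preserving_mul_left_of_norm_eq_one (hc θ)).setLIntegral_comp_preimage hΩ
      (f := fun p => ‖F p‖ₑ ^ 2) (by fun_prop)
    rwa [hpre] at this
  calc ∫⁻ p in Ω, ‖G p‖ₑ ^ 2
      ≤ ∫⁻ p in Ω, k⁻¹ * ∫⁻ θ, ‖F (c θ * p)‖ₑ ^ 2 ∂ν := lintegral_mono_ae h1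
    _ = k⁻¹ * ∫⁻ p in Ω, ∫⁻ θ, ‖F (c θ * p)‖ₑ ^ 2 ∂ν :=
        lintegral_const_mul' _ _ (by simpa using hk0)
    _ = k⁻¹ * ∫⁻ θ, (∫⁻ p in Ω, ‖F (c θ * p)‖ₑ ^ 2) ∂ν := by
        rw [lintegral_lintegral_swap]
        exact (hFc.enorm.pow_const 2).aemeasurable
    _ = ∫⁻ p in Ω, ‖F p‖ₑ ^ 2 := by
        simp_rw [h3]
        rw [lintegral_const, hνu, mul_comm (∫⁻ p in Ω, ‖F p‖ₑ ^ 2), ← mul_assoc,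
          ENNReal.inv_mul_cancel hk0 hkt, one_mul]

/-! ### Areas of slices -/

theorem Complex.measurableSet_annulus (a b : ℝ) :
    MeasurableSet {w : ℂ | a ≤ ‖w‖ ^ 2 ∧ ‖w‖ ^ 2 < b} := by
  have h1 : MeasurableSet {w : ℂ | a ≤ ‖w‖ ^ 2} := measurableSet_le (by fun_prop) (by fun_prop)
  have h2 : MeasurableSet {w : ℂ | ‖w‖ ^ 2 < b} := measurableSet_lt (by fun_prop) (by fun_prop)
  exact h1.inter h2

/-- Area is linear in the squared radius, so a condition on `|w|² - |z|²` turns into an exact slice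
area with no approximation. -/
theorem Complex.volume_annulus {a b : ℝ} (ha : 0 ≤ a) (hab : a ≤ b) :
    volume {w : ℂ | a ≤ ‖w‖ ^ 2 ∧ ‖w‖ ^ 2 < b} = ENNReal.ofReal (Real.pi * (b - a)) := by
  have hset : ∀ c : ℝ, 0 ≤ c → Metric.ball (0 : ℂ) (√c) = {w : ℂ | ‖w‖ ^ 2 < c} := by
    intro c hc
    ext w
    simp [Real.lt_sqrt (norm_nonneg w)]
  have hvol : ∀ c : ℝ, 0 ≤ c → volume {w : ℂ | ‖w‖ ^ 2 < c} = ENNReal.ofReal (Real.pi * c) := by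
    intro c hc
    rw [← hset c hc, Complex.volume_ball, ← ENNReal.ofReal_pow (Real.sqrt_nonneg c),
      Real.sq_sqrt hc, mul_comm, ENNReal.ofReal_mul Real.pi_pos.le]
    congr 1
    rw [← NNReal.coe_real_pi, ENNReal.ofReal_coe_nnreal]
  have hd : {w : ℂ | a ≤ ‖w‖ ^ 2 ∧ ‖w‖ ^ 2 < b} = {w : ℂ | ‖w‖ ^ 2 < b} \ {w : ℂ | ‖w‖ ^ 2 < a} := by
    ext w; simp [and_comm]
  have hsub : {w : ℂ | ‖w‖ ^ 2 < a} ⊆ {w : ℂ | ‖w‖ ^ 2 < b} := fun w hw => lt_of_lt_of_le hw hab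
  rw [hd, measure_sdiff hsub
    (measurableSet_lt (by fun_prop) (by fun_prop)).nullMeasurableSet (by rw [hvol a ha]; simp),
    hvol b (ha.trans hab), hvol a ha, ← ENNReal.ofReal_sub _ (by positivity), mul_sub]

theorem lintegral_fin_two {f : (Fin 2 → ℂ) → ENNReal} (hf : Measurable f) :
    ∫⁻ p, f p = ∫⁻ z : ℂ, ∫⁻ w : ℂ, f ![z, w] := by
  have h := (volume_preserving_finTwoArrow ℂ).symm.lintegral_comp hf
  rw [← h, Measure.volume_eq_prod, lintegral_prod _ (by fun_prop)]
  rfl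

/-- In polar coordinates this is `∫ dr / r` over `r > 1`, the borderline divergence in the plane. -/
theorem lintegral_norm_sq_inv_eq_top :
    ∫⁻ z in {z : ℂ | 1 ≤ ‖z‖}, ENNReal.ofReal ((‖z‖ ^ 2)⁻¹) = ⊤ := by
  by_contra hne
  have hm : MeasurableSet {z : ℂ | 1 ≤ ‖z‖} := measurableSet_le (by fun_prop) (by fun_prop)
  set f : ℝ → ℝ := Set.indicator (Set.Ici 1) fun r => (r ^ 2)⁻¹ with hf
  have hint : Integrable (fun z : ℂ => f ‖z‖) := by
    have h1 : IntegrableOn (fun z : ℂ => (‖z‖ ^ 2)⁻¹) {z : ℂ | 1 ≤ ‖z‖} := by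
      refine ⟨by fun_prop, ?_⟩
      rw [hasFiniteIntegral_iff_ofReal (Filter.Eventually.of_forall fun _ => by positivity)]
      exact lt_top_iff_ne_top.2 hne
    have h2 := h1.integrable_indicator hm
    refine h2.congr (Filter.Eventually.of_forall fun z => ?_)
    simp [hf, Set.indicator]
  rw [integrable_fun_norm_addHaar, Complex.finrank_real_complex] at hint
  refine not_integrableOn_Ioi_inv (a := 1) ?_
  refine (hint.mono_set (Set.Ioi_subset_Ioi zero_le_one)).congr_fun (fun r hr => ?_)
    measurableSet_Ioi
  have hr' : (1 : ℝ) < r := hr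
  simp [hf, hr'.le]
  field_simp

/-! ### The domain `D(α)` -/

theorem mem_reinhardtD {α : ℝ} {p : Fin 2 → ℂ} :
    p ∈ reinhardtD α ↔ |‖p 1‖ ^ 2 - ‖p 0‖ ^ 2| < (1 + ‖p 0‖ ^ 2 + ‖p 1‖ ^ 2) ^ (-α) := Iff.rfl

theorem isReinhardt_reinhardtD (α : ℝ) : IsReinhardt (reinhardtD α) := by
  intro z hz c hc
  rw [mem_reinhardtD] at hz ⊢
  simpa [hc] using hz

/-- Shrinking a point lowers the left side of the defining inequality and, the exponent being
nonpositive, raises the right side. Hence the complex slice through any point of the domain contains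
the closed unit disc, which gives both connectedness and Taylor expansions along slices. -/
theorem smul_mem_reinhardtD {α : ℝ} (hα : 0 ≤ α) {p : Fin 2 → ℂ} (hp : p ∈ reinhardtD α) {c : ℂ}
    (hc : ‖c‖ ≤ 1) : c • p ∈ reinhardtD α := by
  rw [mem_reinhardtD] at hp ⊢
  simp only [Pi.smul_apply, smul_eq_mul, norm_mul, mul_pow, ← mul_sub]
  have hc2 : ‖c‖ ^ 2 ≤ 1 := pow_le_one₀ (norm_nonneg c) hc
  calc |‖c‖ ^ 2 * (‖p 1‖ ^ 2 - ‖p 0‖ ^ 2)| = ‖c‖ ^ 2 * |‖p 1‖ ^ 2 - ‖p 0‖ ^ 2| := by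
        rw [abs_mul, abs_of_nonneg (by positivity)]
    _ ≤ 1 * |‖p 1‖ ^ 2 - ‖p 0‖ ^ 2| := by gcongr
    _ < (1 + ‖p 0‖ ^ 2 + ‖p 1‖ ^ 2) ^ (-α) := by rwa [one_mul]
    _ ≤ (1 + ‖c‖ ^ 2 * ‖p 0‖ ^ 2 + ‖c‖ ^ 2 * ‖p 1‖ ^ 2) ^ (-α) := by
        refine Real.rpow_le_rpow_of_nonpos (by positivity) ?_ (by linarith)
        have h0 := mul_le_of_le_one_left (sq_nonneg ‖p 0‖) hc2
        have h1 := mul_le_of_le_one_left (sq_nonneg ‖p 1‖) hc2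
        linarith

theorem diagonal_mem_reinhardtD (α : ℝ) {p : Fin 2 → ℂ} (hp : ‖p 0‖ = ‖p 1‖) :
    p ∈ reinhardtD α := by
  rw [mem_reinhardtD, hp, sub_self, abs_zero]
  positivity

theorem zero_mem_reinhardtD (α : ℝ) : (0 : Fin 2 → ℂ) ∈ reinhardtD α :=
  diagonal_mem_reinhardtD α (by simp)

theorem isConnected_reinhardtD {α : ℝ} (hα : 0 ≤ α) :
    IsConnected (reinhardtD α : Set (Fin 2 → ℂ)) := by
  have hs : StarConvex ℝ 0 (reinhardtD α : Set (Fin 2 → ℂ)) := by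
    rw [starConvex_zero_iff]
    intro p hp a ha0 ha1
    have := smul_mem_reinhardtD hα hp (c := (a : ℂ)) (by simpa [abs_of_nonneg ha0] using ha1)
    simpa using this
  exact ((hs.isPathConnected (zero_mem_reinhardtD α))).isConnected

theorem not_isBounded_reinhardtD (α : ℝ) :
    ¬ Bornology.IsBounded (reinhardtD α : Set (Fin 2 → ℂ)) := by
  intro h
  obtain ⟨R, hR⟩ := h.exists_norm_le
  have h1 := hR (fun _ => ((|R| + 1 : ℝ) : ℂ)) (diagonal_mem_reinhardtD α rfl)
  rw [pi_norm_const, Complex.norm_real, Real.norm_eq_abs, abs_of_pos (by positivity)] at h1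
  linarith [le_abs_self R]

theorem rotation_mem_reinhardtD_iff (α : ℝ) {c : Fin 2 → ℂ} (hc : ∀ j, ‖c j‖ = 1)
    (p : Fin 2 → ℂ) : c * p ∈ reinhardtD α ↔ p ∈ reinhardtD α := by
  simp [mem_reinhardtD, hc]

/-! ### The two integrals that decide which degrees are square integrable -/

/-- Over `z` the slice contains an annulus of area `π (4|z|²)^(-α)`, so the inner integral is at
least a constant times `|z|^(4-2α) ≥ |z|^(-2)`. Only the half `|z| ≤ |w|` is kept, because there
every power `(w/z)^b` has modulus at least 1. -/
theorem lintegral_norm_pow_four_eq_top {α : ℝ} (h₁ : 0 ≤ α) (h₃ : α < 3) :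
    ∫⁻ p in {p : Fin 2 → ℂ | p ∈ reinhardtD α ∧ 1 ≤ ‖p 0‖ ∧ ‖p 0‖ ≤ ‖p 1‖},
      ENNReal.ofReal (‖p 0‖ ^ 4) = ⊤ := by
  set S : Set (Fin 2 → ℂ) := {p | p ∈ reinhardtD α ∧ 1 ≤ ‖p 0‖ ∧ ‖p 0‖ ≤ ‖p 1‖} with hS
  have hS1 : MeasurableSet {p : Fin 2 → ℂ | 1 ≤ ‖p 0‖} :=
    measurableSet_le (by fun_prop) (by fun_prop)
  have hS2 : MeasurableSet {p : Fin 2 → ℂ | ‖p 0‖ ≤ ‖p 1‖} :=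
    measurableSet_le (by fun_prop) (by fun_prop)
  have hSm : MeasurableSet S := (reinhardtD α).isOpen.measurableSet.inter (hS1.inter hS2)
  have hZm : MeasurableSet {z : ℂ | 1 ≤ ‖z‖} := measurableSet_le (by fun_prop) (by fun_prop)
  rw [← lintegral_indicator hSm, lintegral_fin_two ((by fun_prop : Measurable
    fun p : Fin 2 → ℂ => ENNReal.ofReal (‖p 0‖ ^ 4)).indicator hSm), eq_top_iff]
  set C : ENNReal := ENNReal.ofReal (Real.pi * 4 ^ (-α)) with hC
  have hC0 : C ≠ 0 := by
    simp only [hC, ne_eq, ENNReal.ofReal_eq_zero, not_le]; positivity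
  calc (⊤ : ENNReal) = C * ∫⁻ z in {z : ℂ | 1 ≤ ‖z‖}, ENNReal.ofReal ((‖z‖ ^ 2)⁻¹) := by
        rw [lintegral_norm_sq_inv_eq_top, ENNReal.mul_top hC0]
    _ = ∫⁻ z, {z : ℂ | 1 ≤ ‖z‖}.indicator (fun z => C * ENNReal.ofReal ((‖z‖ ^ 2)⁻¹)) z := by
        rw [lintegral_indicator hZm, lintegral_const_mul' _ _ (by simp [hC])]
    _ ≤ _ := by
        refine lintegral_mono fun z => ?_
        by_cases hz : 1 ≤ ‖z‖
        swap
        · simp [hz]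
        -- The 4 comes from `1 + |z|² + |w|² ≤ 2 + 2|z|² ≤ 4|z|²`, valid for `|z| ≥ 1` and `|w|² ≤
        -- |z|² + 1`.
        set δ : ℝ := (4 * ‖z‖ ^ 2) ^ (-α) with hδ
        have hz2 : 1 ≤ ‖z‖ ^ 2 := one_le_pow₀ hz
        have hδ0 : 0 < δ := by positivity
        have hδ1 : δ ≤ 1 := Real.rpow_le_one_of_one_le_of_nonpos (by linarith) (by linarith)
        have hvol := Complex.volume_annulus (a := ‖z‖ ^ 2) (b := ‖z‖ ^ 2 + δ) (by positivity)
          (by linarith)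
        set A : Set ℂ := {w : ℂ | ‖z‖ ^ 2 ≤ ‖w‖ ^ 2 ∧ ‖w‖ ^ 2 < ‖z‖ ^ 2 + δ} with hA
        have hAm : MeasurableSet A := Complex.measurableSet_annulus _ _
        have hAS : ∀ w ∈ A, ![z, w] ∈ S := by
          rintro w ⟨hw1, hw2⟩
          refine ⟨?_, by simpa using hz, by simpa using (sq_le_sq₀ (norm_nonneg _) (norm_nonneg _)).1 hw1⟩
          rw [mem_reinhardtD]
          simp only [Matrix.cons_val_zero, Matrix.cons_val_one]
          rw [abs_of_nonneg (by linarith)]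
          refine (by linarith : ‖w‖ ^ 2 - ‖z‖ ^ 2 < δ).trans_le ?_
          exact Real.rpow_le_rpow_of_nonpos (by positivity) (by linarith) (by linarith)
        calc {z : ℂ | 1 ≤ ‖z‖}.indicator (fun z => C * ENNReal.ofReal ((‖z‖ ^ 2)⁻¹)) z
            = C * ENNReal.ofReal ((‖z‖ ^ 2)⁻¹) := by simp [hz]
          _ ≤ ENNReal.ofReal (‖z‖ ^ 4) * volume A := by
              rw [hvol, hC, ← ENNReal.ofReal_mul (by positivity), ← ENNReal.ofReal_mul (by positivity)]
              apply ENNReal.ofReal_le_ofReal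
              rw [add_sub_cancel_left, hδ, Real.mul_rpow (by norm_num) (by positivity)]
              have h5 : (‖z‖ ^ 2)⁻¹ ≤ ‖z‖ ^ 4 * (‖z‖ ^ 2) ^ (-α) := by
                have e1 : ‖z‖ ^ 4 = (‖z‖ ^ 2) ^ (2 : ℝ) := by
                  rw [Real.rpow_two]; ring
                rw [e1, ← Real.rpow_add (by positivity), ← Real.rpow_neg_one]
                exact Real.rpow_le_rpow_of_exponent_le hz2 (by linarith)
              calc Real.pi * 4 ^ (-α) * (‖z‖ ^ 2)⁻¹
                  ≤ Real.pi * 4 ^ (-α) * (‖z‖ ^ 4 * (‖z‖ ^ 2) ^ (-α)) := by gcongr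
                _ = _ := by ring
          _ = ∫⁻ w in A, ENNReal.ofReal (‖z‖ ^ 4) := by simp
          _ = ∫⁻ w, A.indicator (fun _ => ENNReal.ofReal (‖z‖ ^ 4)) w := by
              rw [lintegral_indicator hAm]
          _ ≤ _ := by
              refine lintegral_mono fun w => ?_
              by_cases hw : w ∈ A
              · simp [hw, hAS w hw]
              · simp [hw]

/-- On the slice over `z` the integrand is at most `2(1 + |z|²)` and the area at most `2π(1 +
|z|²)^(-α)`. The resulting bound `4π(1 + |z|²)^(1-α)` is integrable on the plane because `2(α - 1) >
2`. -/
theorem lintegral_one_add_norm_sq_lt_top {α : ℝ} (h₂ : 2 < α) :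
    ∫⁻ p in (reinhardtD α : Set (Fin 2 → ℂ)), ENNReal.ofReal (1 + ‖p 0‖ ^ 2 + ‖p 1‖ ^ 2) < ⊤ := by
  have hDm : MeasurableSet (reinhardtD α : Set (Fin 2 → ℂ)) := (reinhardtD α).isOpen.measurableSet
  rw [← lintegral_indicator hDm, lintegral_fin_two ((by fun_prop : Measurable
    fun p : Fin 2 → ℂ => ENNReal.ofReal (1 + ‖p 0‖ ^ 2 + ‖p 1‖ ^ 2)).indicator hDm)]
  have hint := integrable_rpow_neg_one_add_norm_sq (E := ℂ) (μ := volume) (r := 2 * (α - 1))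
    (by rw [Complex.finrank_real_complex]; push_cast; linarith)
  have hlt : ∫⁻ z : ℂ, ENNReal.ofReal (4 * Real.pi * (1 + ‖z‖ ^ 2) ^ (-(2 * (α - 1)) / 2)) < ⊤ :=
    (hint.const_mul (4 * Real.pi)).lintegral_lt_top
  refine lt_of_le_of_lt (lintegral_mono fun z => ?_) hlt
  set δ : ℝ := (1 + ‖z‖ ^ 2) ^ (-α) with hδ
  have hz2 : 0 ≤ ‖z‖ ^ 2 := by positivity
  have hδ0 : 0 < δ := by positivity
  have hδ1 : δ ≤ 1 := Real.rpow_le_one_of_one_le_of_nonpos (by linarith) (by linarith)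
  -- Near the origin the slice is a disc rather than an annulus, hence the truncation at 0.
  set a : ℝ := max 0 (‖z‖ ^ 2 - δ) with ha
  have hab : a ≤ ‖z‖ ^ 2 + δ := max_le (by positivity) (by linarith)
  have hvol := Complex.volume_annulus (a := a) (b := ‖z‖ ^ 2 + δ) (le_max_left _ _) hab
  set A : Set ℂ := {w : ℂ | a ≤ ‖w‖ ^ 2 ∧ ‖w‖ ^ 2 < ‖z‖ ^ 2 + δ} with hA
  have hAm : MeasurableSet A := Complex.measurableSet_annulus _ _
  have hDA : ∀ w, ![z, w] ∈ reinhardtD α → w ∈ A := by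
    intro w hw
    rw [mem_reinhardtD] at hw
    simp only [Matrix.cons_val_zero, Matrix.cons_val_one] at hw
    have hw2 : |‖w‖ ^ 2 - ‖z‖ ^ 2| < δ := hw.trans_le
      (Real.rpow_le_rpow_of_nonpos (by positivity) (by nlinarith [sq_nonneg ‖w‖]) (by linarith))
    rw [abs_lt] at hw2
    exact ⟨max_le (by positivity) (by linarith), by linarith⟩
  calc _ ≤ ∫⁻ w, A.indicator (fun _ => ENNReal.ofReal (2 * (1 + ‖z‖ ^ 2))) w := by
        refine lintegral_mono fun w => ?_
        by_cases hw : ![z, w] ∈ reinhardtD α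
        · have hwA := hDA w hw
          rw [Set.indicator_of_mem (SetLike.mem_coe.2 hw), Set.indicator_of_mem hwA]
          apply ENNReal.ofReal_le_ofReal
          have := hwA.2
          simp only [Matrix.cons_val_zero, Matrix.cons_val_one]
          linarith
        · rw [Set.indicator_of_notMem (fun h => hw (SetLike.mem_coe.1 h))]
          exact zero_le
    _ = ENNReal.ofReal (2 * (1 + ‖z‖ ^ 2)) * volume A := by
        rw [lintegral_indicator hAm]; simp
    _ ≤ _ := by
        rw [hvol, ← ENNReal.ofReal_mul (by positivity)]
        apply ENNReal.ofReal_le_ofReal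
        have h1 : ‖z‖ ^ 2 + δ - a ≤ 2 * δ := by
          have := le_max_right 0 (‖z‖ ^ 2 - δ)
          linarith
        have h2 : (1 + ‖z‖ ^ 2) ^ (-(2 * (α - 1)) / 2) = (1 + ‖z‖ ^ 2) * δ := by
          rw [show -(2 * (α - 1)) / 2 = 1 + -α by ring, Real.rpow_add (by positivity),
            Real.rpow_one]
        rw [h2]
        calc 2 * (1 + ‖z‖ ^ 2) * (Real.pi * (‖z‖ ^ 2 + δ - a))
            ≤ 2 * (1 + ‖z‖ ^ 2) * (Real.pi * (2 * δ)) := by gcongr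
          _ = _ := by ring

/-! ### Homogeneous parts of holomorphic functions -/

/-- Cauchy's estimate, kept as a mean over the circle rather than a supremum so that it can be
integrated over the domain. -/
theorem norm_taylorCoeff_le_circle_mean {g : ℂ → ℂ}
    (hg : DifferentiableOn ℂ g (Metric.closedBall 0 1)) (k : ℕ) :
    ‖(k.factorial : ℂ)⁻¹ * iteratedDeriv k g 0‖ ≤
      (2 * Real.pi)⁻¹ * ∫ θ in (0 : ℝ)..2 * Real.pi, ‖g (Complex.exp (θ * Complex.I))‖ := by
  have h := DifferentiableOn.hasFPowerSeriesOnBall (R := 1) (by simpa using hg) zero_lt_one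
  have h2 := h.factorial_smul 1 k
  rw [← iteratedDeriv_eq_iteratedFDeriv] at h2
  have hk : (k.factorial : ℂ) ≠ 0 := by exact_mod_cast k.factorial_ne_zero
  rw [← h2, nsmul_eq_mul, inv_mul_cancel_left₀ hk]
  have h3 := norm_cauchyPowerSeries_le g 0 1 k
  simp only [abs_one, inv_one, one_pow, mul_one, circleMap_zero, Complex.ofReal_one, one_mul] at h3
  refine le_trans ?_ h3
  refine ((cauchyPowerSeries g 0 1 k).le_opNorm _).trans ?_
  simp

theorem taylorCoeff_eq_circleIntegral {g : ℂ → ℂ} {ρ : ℝ} (hρ : 0 < ρ)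
    (hg : DifferentiableOn ℂ g (Metric.closedBall 0 ρ)) (k : ℕ) :
    (k.factorial : ℂ)⁻¹ * iteratedDeriv k g 0 =
      (2 * Real.pi * Complex.I)⁻¹ * ∮ t in C(0, ρ), (t ^ (k + 1))⁻¹ * g t := by
  have h := DiffContOnCl.circleIntegral_one_div_sub_center_pow_smul hρ k
    (hg.diffContOnCl_ball subset_rfl)
  simp only [sub_zero, one_div, smul_eq_mul] at h
  rw [h]
  have := Complex.two_pi_I_ne_zero
  field_simp

theorem iteratedDeriv_comp_mul_zero {g : ℂ → ℂ} (hg : ∀ᶠ t in nhds 0, DifferentiableAt ℂ g t)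
    (k : ℕ) {c : ℂ} (hc : c ≠ 0) :
    iteratedDeriv k (fun t => g (c * t)) 0 = c ^ k * iteratedDeriv k g 0 := by
  -- A contraction maps a small disc into itself, so the chain rule applies there. For `‖c‖ ≥ 1` the
  -- same statement is used for `t ↦ g (c * t)` and `c⁻¹`.
  have key : ∀ (g : ℂ → ℂ) (c : ℂ), (∀ᶠ t in nhds 0, DifferentiableAt ℂ g t) → ‖c‖ ≤ 1 →
      iteratedDeriv k (fun t => g (c * t)) 0 = c ^ k * iteratedDeriv k g 0 := by
    intro g c hg hc
    obtain ⟨r, hr, h⟩ := Metric.eventually_nhds_iff_ball.1 hg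
    have hd : DifferentiableOn ℂ g (Metric.ball 0 r) := fun t ht => (h t ht).differentiableWithinAt
    have h0 : (0 : ℂ) ∈ Metric.ball (0 : ℂ) r := Metric.mem_ball_self hr
    have := iteratedDerivWithin_comp_const_smul (n := k) h0 Metric.isOpen_ball.uniqueDiffOn
      (hd.contDiffOn Metric.isOpen_ball) c (by
        intro t ht
        rw [mem_ball_zero_iff] at ht ⊢
        rw [norm_mul]
        exact (mul_le_of_le_one_left (norm_nonneg t) hc).trans_lt ht)
    rwa [iteratedDerivWithin_of_isOpen Metric.isOpen_ball h0, mul_zero,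
      iteratedDerivWithin_of_isOpen Metric.isOpen_ball h0, smul_eq_mul] at this
  rcases le_total ‖c‖ 1 with h | h
  · exact key g c hg h
  · have hg' : ∀ᶠ t in nhds (0 : ℂ), DifferentiableAt ℂ (fun t => g (c * t)) t := by
      have ht : Filter.Tendsto (fun t : ℂ => c * t) (nhds 0) (nhds 0) := by
        simpa using (continuous_const_mul c).tendsto 0
      filter_upwards [ht.eventually hg] with t ht
      exact DifferentiableAt.comp t ht (by fun_prop)
    have := key _ c⁻¹ hg' (by rw [norm_inv]; exact inv_le_one_of_one_le₀ h)
    simp only [mul_inv_cancel_left₀ hc] at this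
    rw [this, ← mul_assoc, ← mul_pow, mul_inv_cancel₀ hc, one_pow, one_mul]

/-- The homogeneous part of degree `k` at the origin of a holomorphic function. -/
def homogeneousPart {n : ℕ} (F : (Fin n → ℂ) → ℂ) (k : ℕ) (p : Fin n → ℂ) : ℂ :=
  (k.factorial : ℂ)⁻¹ * iteratedDeriv k (fun t : ℂ => F (t • p)) 0

section

variable {n : ℕ} {F : (Fin n → ℂ) → ℂ} {Ω : Opens (Fin n → ℂ)}

theorem eventually_differentiableAt_slice (hF : DifferentiableOn ℂ F Ω) (h0 : 0 ∈ Ω)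
    (p : Fin n → ℂ) : ∀ᶠ t in nhds (0 : ℂ), DifferentiableAt ℂ (fun t : ℂ => F (t • p)) t := by
  have ht : Filter.Tendsto (fun t : ℂ => t • p) (nhds 0) (nhds 0) := by
    have hc : Continuous fun t : ℂ => t • p := by fun_prop
    simpa using hc.tendsto 0
  filter_upwards [ht.eventually (Ω.isOpen.mem_nhds h0)] with t ht
  exact (hF.differentiableAt (Ω.isOpen.mem_nhds ht)).comp t
    (by fun_prop : DifferentiableAt ℂ (fun t : ℂ => t • p) t)

/-- Only the germ of `F` at 0 enters, so homogeneity holds on all of `ℂⁿ`, not merely on `Ω`. -/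
theorem homogeneousPart_smul (hF : DifferentiableOn ℂ F Ω) (h0 : 0 ∈ Ω) (k : ℕ) {c : ℂ}
    (hc : c ≠ 0) (p : Fin n → ℂ) :
    homogeneousPart F k (c • p) = c ^ k * homogeneousPart F k p := by
  have h := iteratedDeriv_comp_mul_zero (eventually_differentiableAt_slice hF h0 p) k hc
  have he : (fun t : ℂ => F (t • c • p)) = fun t => F ((c * t) • p) := by
    funext t
    rw [smul_smul, mul_comm]
  rw [homogeneousPart, homogeneousPart, he, h]
  ring

theorem differentiableOn_slice (hF : DifferentiableOn ℂ F Ω)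
    (hbal : ∀ p ∈ Ω, ∀ c : ℂ, ‖c‖ ≤ 1 → c • p ∈ Ω) {p : Fin n → ℂ} (hp : p ∈ Ω) :
    DifferentiableOn ℂ (fun t : ℂ => F (t • p)) (Metric.closedBall 0 1) := by
  intro t ht
  have := hbal p hp t (by simpa using ht)
  exact (((hF.differentiableAt (Ω.isOpen.mem_nhds this)).comp t
    (by fun_prop : DifferentiableAt ℂ (fun t : ℂ => t • p) t)) :
    DifferentiableAt ℂ (fun t : ℂ => F (t • p)) t).differentiableWithinAt

theorem norm_homogeneousPart_le (hF : DifferentiableOn ℂ F Ω)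
    (hbal : ∀ p ∈ Ω, ∀ c : ℂ, ‖c‖ ≤ 1 → c • p ∈ Ω) {p : Fin n → ℂ} (hp : p ∈ Ω) (k : ℕ) :
    ‖homogeneousPart F k p‖ ≤ (2 * Real.pi)⁻¹ *
      ∫ θ in (0 : ℝ)..2 * Real.pi, ‖F (Complex.exp (θ * Complex.I) • p)‖ :=
  norm_taylorCoeff_le_circle_mean (differentiableOn_slice hF hbal hp) k

theorem homogeneousPart_one (hF : DifferentiableAt ℂ F 0) (p : Fin n → ℂ) :
    homogeneousPart F 1 p = fderiv ℂ F 0 p := by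
  have h1 : HasFDerivAt F (fderiv ℂ F 0) ((0 : ℂ) • p) := by
    rw [zero_smul]; exact hF.hasFDerivAt
  have h2 : HasDerivAt (fun t : ℂ => t • p) p 0 := by
    simpa using (hasDerivAt_id (0 : ℂ)).smul_const p
  rw [homogeneousPart, iteratedDeriv_one]
  have h3 : deriv (fun t : ℂ => F (t • p)) 0 = fderiv ℂ F 0 p := (h1.comp_hasDerivAt (0 : ℂ) h2).deriv
  simp [h3]

/-- Restricted to complex affine lines, homogeneous parts are holomorphic. -/
theorem differentiable_homogeneousPart_line (hF : DifferentiableOn ℂ F Ω) (h0 : 0 ∈ Ω) (k : ℕ)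
    (a b : Fin n → ℂ) : Differentiable ℂ fun u : ℂ => homogeneousPart F k (a + u • b) := by
  intro u₀
  obtain ⟨r, hr, hrΩ⟩ := Metric.isOpen_iff.1 Ω.isOpen 0 h0
  -- `M` bounds the line over the disc of radius 2 about `u₀`. The circle of radius `ρ = r / (2M)`
  -- then keeps every scaled point within `r / 2` of the origin, inside `Ω`, even if the line itself
  -- leaves `Ω`.
  set M : ℝ := ‖a‖ + (‖u₀‖ + 2) * ‖b‖ + 1 with hM
  have hM0 : 0 < M := by positivity
  set ρ : ℝ := r / (2 * M) with hρ
  have hρ0 : 0 < ρ := by positivity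
  have hmem : ∀ t u : ℂ, ‖t‖ ≤ ρ → ‖u‖ ≤ ‖u₀‖ + 2 → ‖t • (a + u • b)‖ ≤ r / 2 := by
    intro t u ht hu
    have h1 : ‖a + u • b‖ ≤ M := by
      calc ‖a + u • b‖ ≤ ‖a‖ + ‖u‖ * ‖b‖ := (norm_add_le _ _).trans_eq (by rw [norm_smul])
        _ ≤ ‖a‖ + (‖u₀‖ + 2) * ‖b‖ := by gcongr
        _ ≤ M := by linarith
    calc ‖t • (a + u • b)‖ ≤ ρ * M := by rw [norm_smul]; gcongr
      _ = r / 2 := by rw [hρ]; field_simp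
  have hcb : Metric.closedBall (0 : Fin n → ℂ) (r / 2) ⊆ Ω :=
    (Metric.closedBall_subset_ball (by linarith)).trans hrΩ
  obtain ⟨C, hC⟩ := (isCompact_closedBall (0 : Fin n → ℂ) (r / 2)).exists_bound_of_continuousOn
    (hF.continuousOn.mono hcb)
  have hdiff : ∀ t u : ℂ, ‖t‖ ≤ ρ → ‖u‖ ≤ ‖u₀‖ + 2 → DifferentiableAt ℂ F (t • (a + u • b)) :=
    fun t u ht hu => hF.differentiableAt
      (Ω.isOpen.mem_nhds (hcb (by simpa using hmem t u ht hu)))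
  have hub : ∀ u ∈ Metric.closedBall u₀ 2, ‖u‖ ≤ ‖u₀‖ + 2 := by
    intro u hu
    have := norm_le_norm_add_norm_sub' u u₀
    rw [mem_closedBall_iff_norm] at hu
    linarith
  have hcm : ∀ θ, ‖circleMap 0 ρ θ‖ = ρ := fun θ => by simp [abs_of_pos hρ0]
  have hcm0 : ∀ θ, circleMap 0 ρ θ ≠ 0 := fun θ => circleMap_ne_center hρ0.ne'
  -- Cauchy's formula on this fixed circle makes the homogeneous part a parameter integral, which is
  -- then differentiated in `u`.
  have hform : ∀ u ∈ Metric.closedBall u₀ 2, homogeneousPart F k (a + u • b) =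
      (2 * Real.pi * Complex.I)⁻¹ * ∫ θ in (0 : ℝ)..2 * Real.pi, deriv (circleMap 0 ρ) θ *
        ((circleMap 0 ρ θ ^ (k + 1))⁻¹ * F (circleMap 0 ρ θ • (a + u • b))) := by
    intro u hu
    rw [homogeneousPart, taylorCoeff_eq_circleIntegral hρ0]
    · rfl
    · intro t ht
      exact ((hdiff t u (by simpa using ht) (hub u hu)).comp t
        (by fun_prop : DifferentiableAt ℂ (fun t : ℂ => t • (a + u • b)) t) :
        DifferentiableAt ℂ (fun t : ℂ => F (t • (a + u • b))) t).differentiableWithinAt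
  set W : ℝ → ℂ := fun θ => deriv (circleMap 0 ρ) θ * (circleMap 0 ρ θ ^ (k + 1))⁻¹ with hW
  have hWc : Continuous W := by
    have h1 : Continuous fun θ => (circleMap 0 ρ θ ^ (k + 1))⁻¹ :=
      ((continuous_circleMap 0 ρ).pow _).inv₀ fun θ => pow_ne_zero _ (hcm0 θ)
    have h2 : Continuous (deriv (circleMap 0 ρ)) := by
      have : deriv (circleMap 0 ρ) = fun θ => circleMap 0 ρ θ * Complex.I := by
        funext θ; simp
      rw [this]
      exact (continuous_circleMap 0 ρ).mul continuous_const
    exact h2.mul h1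
  have hd1 : ∀ (θ : ℝ), ∀ u ∈ Metric.closedBall u₀ 2,
      HasDerivAt (fun u : ℂ => F (circleMap 0 ρ θ • (a + u • b)))
        (circleMap 0 ρ θ * fderiv ℂ F (circleMap 0 ρ θ • (a + u • b)) b) u := by
    intro θ u hu
    have h1 := (hdiff (circleMap 0 ρ θ) u (hcm θ).le (hub u hu)).hasFDerivAt
    have h2 : HasDerivAt (fun u : ℂ => circleMap 0 ρ θ • (a + u • b)) (circleMap 0 ρ θ • b) u := by
      have h4 := ((hasDerivAt_id u).smul_const b).const_add a |>.const_smul (circleMap 0 ρ θ)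
      rw [one_smul] at h4
      exact h4
    have h3 := h1.comp_hasDerivAt u h2
    rwa [map_smul, smul_eq_mul] at h3
  -- Cauchy's estimate on the unit disc about `u` turns the bound `C` on `F` into the domination of
  -- the derivative; this is why `F` was controlled up to radius 2.
  have hb1 : ∀ (θ : ℝ), ∀ u ∈ Metric.ball u₀ 1,
      ‖circleMap 0 ρ θ * fderiv ℂ F (circleMap 0 ρ θ • (a + u • b)) b‖ ≤ C := by
    intro θ u hu
    rw [mem_ball_iff_norm] at hu
    have hsub : Metric.closedBall u 1 ⊆ Metric.closedBall u₀ 2 := by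
      refine Metric.closedBall_subset_closedBall' ?_
      rw [dist_eq_norm]; linarith
    rw [← (hd1 θ u (hsub (Metric.mem_closedBall_self zero_le_one))).deriv]
    have := Complex.norm_deriv_le_of_forall_mem_sphere_norm_le (c := u) (R := 1) (C := C)
      (f := fun u : ℂ => F (circleMap 0 ρ θ • (a + u • b))) one_pos
      (DifferentiableOn.diffContOnCl_ball (U := Metric.closedBall u 1) (fun v hv =>
        (hd1 θ v (hsub hv)).differentiableAt.differentiableWithinAt) subset_rfl)
      (fun v hv => hC _ (by
        simpa using hmem _ v (hcm θ).le (hub v (hsub (Metric.sphere_subset_closedBall hv)))))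
    simpa using this
  have hcont : ∀ u ∈ Metric.closedBall u₀ 2,
      Continuous fun θ => F (circleMap 0 ρ θ • (a + u • b)) := by
    intro u hu
    rw [continuous_iff_continuousAt]
    intro θ
    exact ContinuousAt.comp (f := fun θ => circleMap 0 ρ θ • (a + u • b))
      (hdiff (circleMap 0 ρ θ) u (hcm θ).le (hub u hu)).continuousAt
      ((continuous_circleMap 0 ρ).smul continuous_const).continuousAt
  have hu₀ : u₀ ∈ Metric.closedBall u₀ 2 := Metric.mem_closedBall_self zero_le_two
  have hlt : Metric.ball u₀ 1 ⊆ Metric.closedBall u₀ 2 :=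
    Metric.ball_subset_closedBall.trans (Metric.closedBall_subset_closedBall (by norm_num))
  have hmain := hasDerivAt_integral_of_dominated_loc_of_deriv_le (𝕜 := ℂ)
    (μ := volume.restrict (Set.Ioc 0 (2 * Real.pi)))
    (F := fun u θ => W θ * F (circleMap 0 ρ θ • (a + u • b)))
    (F' := fun u θ => W θ *
      (circleMap 0 ρ θ * fderiv ℂ F (circleMap 0 ρ θ • (a + u • b)) b))
    (x₀ := u₀) (s := Metric.ball u₀ 1) (bound := fun θ => ‖W θ‖ * C)
    (Metric.ball_mem_nhds _ one_pos)
    (by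
      filter_upwards [Metric.ball_mem_nhds u₀ one_pos] with u hu
      exact (hWc.mul (hcont u (hlt hu))).aestronglyMeasurable)
    ((hWc.mul (hcont u₀ hu₀)).integrableOn_Ioc)
    (by
      refine Measurable.aestronglyMeasurable ?_
      have h1 : Measurable fun θ => fderiv ℂ F (circleMap 0 ρ θ • (a + u₀ • b)) b :=
        (measurable_fderiv_apply_const ℂ F b).comp
          ((continuous_circleMap 0 ρ).smul continuous_const).measurable
      exact hWc.measurable.mul ((continuous_circleMap 0 ρ).measurable.mul h1))
    (Filter.Eventually.of_forall fun θ u hu => by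
      rw [norm_mul]
      exact mul_le_mul_of_nonneg_left (hb1 θ u hu) (norm_nonneg _))
    ((hWc.norm.mul continuous_const).integrableOn_Ioc)
    (Filter.Eventually.of_forall fun θ u hu => (hd1 θ u (hlt hu)).const_mul (W θ))
  refine (hmain.2.differentiableAt.const_mul (2 * Real.pi * Complex.I)⁻¹).congr_of_eventuallyEq ?_
  filter_upwards [Metric.ball_mem_nhds u₀ one_pos] with u hu
  rw [hform u (hlt hu), intervalIntegral.integral_of_le (by positivity)]
  simp only [hW, mul_assoc]

end

/-! ### The Bergman space of `D(α)` -/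

theorem ae_coord_ne_zero {n : ℕ} (j : Fin n) : ∀ᵐ p : Fin n → ℂ, p j ≠ 0 := by
  have h : volume {z : ℂ | ¬ z ≠ 0} = 0 := by simp
  exact (Measure.tendsto_eval_ae_ae (μ := fun _ : Fin n => (volume : Measure ℂ))).eventually
    (mem_ae_iff.2 h)

theorem measurable_zeroExt {n : ℕ} {Ω : Opens (Fin n → ℂ)} {f : Ω → ℂ}
    (hf : ContinuousOn (zeroExt Ω f) Ω) : Measurable (zeroExt Ω f) := by
  have h : (Ω : Set (Fin n → ℂ)).indicator (zeroExt Ω f) = zeroExt Ω f := by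
    funext p
    by_cases hp : p ∈ Ω
    · simp [hp]
    · simp [hp, zeroExt]
  rw [← h]
  classical
  rw [← Set.piecewise_eq_indicator]
  exact hf.measurable_piecewise continuousOn_const Ω.isOpen.measurableSet

/-- The homogeneous parts of degree at least two of a square integrable holomorphic function on
`D(α)` vanish. -/
theorem homogeneousPart_eq_zero {α : ℝ} (h₁ : 0 ≤ α) (h₃ : α < 3) {F : (Fin 2 → ℂ) → ℂ}
    (hFm : Measurable F) (hF : DifferentiableOn ℂ F (reinhardtD α))
    (hF2 : ∫⁻ p in (reinhardtD α : Set (Fin 2 → ℂ)), ‖F p‖ₑ ^ 2 < ⊤) {k : ℕ} (hk : 2 ≤ k)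
    {p : Fin 2 → ℂ} (hp : p 0 ≠ 0) : homogeneousPart F k p = 0 := by
  set D : Set (Fin 2 → ℂ) := (reinhardtD α : Set (Fin 2 → ℂ)) with hD
  have hDm : MeasurableSet D := (reinhardtD α).isOpen.measurableSet
  have h0 := zero_mem_reinhardtD α
  -- Dehomogenisation `h(u) = F_k(1, u)`. It is entire, and `F_k(z, w) = z^k h(w/z)` where `z ≠ 0`.
  set h : ℂ → ℂ := fun u => homogeneousPart F k (![1, 0] + u • ![0, 1]) with hh
  have hd : Differentiable ℂ h := differentiable_homogeneousPart_line hF h0 k _ _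
  have hG : ∀ p : Fin 2 → ℂ, p 0 ≠ 0 → homogeneousPart F k p = p 0 ^ k * h (p 1 / p 0) := by
    intro p hp
    rw [hh, ← homogeneousPart_smul hF h0 k hp]
    congr 1
    funext j
    fin_cases j
    · simp
    · simp [mul_div_cancel₀ _ hp]
  set G : (Fin 2 → ℂ) → ℂ := fun p => p 0 ^ k * h (p 1 / p 0) with hGdef
  have hGm : Measurable G := by
    have := hd.continuous.measurable
    fun_prop
  have hG2 : ∫⁻ p in D, ‖G p‖ₑ ^ 2 ≤ ∫⁻ p in D, ‖F p‖ₑ ^ 2 := by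
    refine lintegral_sq_le_of_le_circle_mean hDm
      (c := fun θ _ => Complex.exp (θ * Complex.I)) (by fun_prop)
      (fun θ _ => Complex.norm_exp_ofReal_mul_I θ)
      (fun θ p => rotation_mem_reinhardtD_iff α (fun _ => Complex.norm_exp_ofReal_mul_I θ) p) hFm ?_
    filter_upwards [ae_coord_ne_zero 0] with p hp hpD
    rw [hGdef]
    simp only
    rw [← hG p hp]
    exact norm_homogeneousPart_le hF (fun p hp c hc => smul_mem_reinhardtD h₁ hp hc) hpD k
  have hcoef : ∀ b : ℕ, (b.factorial : ℂ)⁻¹ * iteratedDeriv b h 0 = 0 := by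
    intro b
    set a : ℂ := (b.factorial : ℂ)⁻¹ * iteratedDeriv b h 0 with ha
    by_contra hne
    -- All `b` are treated alike: `b > k` gives a Laurent monomial, so it is never needed that `h`
    -- is a polynomial of degree at most `k`.
    set M : (Fin 2 → ℂ) → ℂ := fun p => a * (p 0 ^ k * (p 1 / p 0) ^ b) with hM
    have hM2 : ∫⁻ p in D, ‖M p‖ₑ ^ 2 ≤ ∫⁻ p in D, ‖G p‖ₑ ^ 2 := by
      have hc : ∀ (θ : ℝ) (j : Fin 2), ‖(![1, Complex.exp (θ * Complex.I)] : Fin 2 → ℂ) j‖ = 1 := by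
        intro θ j
        fin_cases j
        · simp
        · simp [Complex.norm_exp_ofReal_mul_I]
      refine lintegral_sq_le_of_le_circle_mean hDm
        (c := fun θ => ![1, Complex.exp (θ * Complex.I)]) ?_ hc
        (fun θ p => rotation_mem_reinhardtD_iff α (hc θ) p) hGm ?_
      · refine continuous_pi fun j => ?_
        fin_cases j
        · exact continuous_const
        · simp only [Fin.mk_one, Matrix.cons_val_one]
          fun_prop
      · filter_upwards [ae_coord_ne_zero 0, ae_coord_ne_zero 1] with p hp0 hp1 hpD
        -- Rotating `w` alone isolates the coefficient of `(w/z)^b`.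
        have hg := norm_taylorCoeff_le_circle_mean
          (g := fun t => p 0 ^ k * h (p 1 / p 0 * t)) (by
            have : Differentiable ℂ fun t => p 0 ^ k * h (p 1 / p 0 * t) := by fun_prop
            exact this.differentiableOn) b
        rw [iteratedDeriv_const_mul_field,
          iteratedDeriv_comp_mul_zero (Filter.Eventually.of_forall fun t => hd t) b
            (div_ne_zero hp1 hp0)] at hg
        convert hg using 2
        · rw [hM, ha]; ring
        · refine intervalIntegral.integral_congr fun θ _ => ?_
          simp only [hGdef, Pi.mul_apply, Matrix.cons_val_zero, Matrix.cons_val_one, one_mul]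
          congr 3
          ring
    have htop : ∫⁻ p in D, ‖M p‖ₑ ^ 2 = ⊤ := by
      rw [eq_top_iff]
      have ha0 : ENNReal.ofReal (‖a‖ ^ 2) ≠ 0 := by
        simp only [ne_eq, ENNReal.ofReal_eq_zero, not_le]; positivity
      set S : Set (Fin 2 → ℂ) := {p | p ∈ reinhardtD α ∧ 1 ≤ ‖p 0‖ ∧ ‖p 0‖ ≤ ‖p 1‖} with hS
      have hS1 : MeasurableSet {p : Fin 2 → ℂ | 1 ≤ ‖p 0‖} :=
        measurableSet_le (by fun_prop) (by fun_prop)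
      have hS2 : MeasurableSet {p : Fin 2 → ℂ | ‖p 0‖ ≤ ‖p 1‖} :=
        measurableSet_le (by fun_prop) (by fun_prop)
      have hSm : MeasurableSet S := hDm.inter (hS1.inter hS2)
      calc (⊤ : ENNReal)
          = ENNReal.ofReal (‖a‖ ^ 2) * ∫⁻ p in S, ENNReal.ofReal (‖p 0‖ ^ 4) := by
            rw [lintegral_norm_pow_four_eq_top h₁ h₃, ENNReal.mul_top ha0]
        _ = ∫⁻ p in S, ENNReal.ofReal (‖a‖ ^ 2) * ENNReal.ofReal (‖p 0‖ ^ 4) := by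
            rw [lintegral_const_mul' _ _ ENNReal.ofReal_ne_top]
        _ ≤ ∫⁻ p in S, ‖M p‖ₑ ^ 2 := by
            refine setLIntegral_mono' hSm fun p hp => ?_
            obtain ⟨-, hp1, hp2⟩ := hp
            have hp0 : 0 < ‖p 0‖ := by linarith
            rw [← ENNReal.ofReal_mul (by positivity), ← ofReal_norm,
              ← ENNReal.ofReal_pow (norm_nonneg _)]
            apply ENNReal.ofReal_le_ofReal
            have h5 : ‖p 0‖ ^ 2 ≤ ‖p 0‖ ^ k * (‖p 1‖ / ‖p 0‖) ^ b := by
              calc ‖p 0‖ ^ 2 ≤ ‖p 0‖ ^ k := pow_le_pow_right₀ hp1 hk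
                _ ≤ _ := le_mul_of_one_le_right (by positivity)
                    (one_le_pow₀ ((one_le_div hp0).2 hp2))
            calc ‖a‖ ^ 2 * ‖p 0‖ ^ 4 = (‖a‖ * ‖p 0‖ ^ 2) ^ 2 := by ring
              _ ≤ (‖a‖ * (‖p 0‖ ^ k * (‖p 1‖ / ‖p 0‖) ^ b)) ^ 2 := by gcongr
              _ = ‖M p‖ ^ 2 := by simp [hM]
        _ ≤ ∫⁻ p in D, ‖M p‖ₑ ^ 2 := lintegral_mono_set fun p hp => hp.1
    exact absurd htop ((hM2.trans hG2).trans_lt hF2).ne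
  have hzero : ∀ u, h u = 0 := by
    intro u
    rw [← Complex.taylorSeries_eq_of_entire' (c := 0) (z := u) hd]
    simp [hcoef]
  rw [hG p hp, hzero, mul_zero]

/-- Along each slice `t ↦ F (t • p)` the Taylor series stops after the linear term. -/
theorem eq_affine_of_mem_bergmanSpace {α : ℝ} (h₁ : 0 ≤ α) (h₃ : α < 3) {f : reinhardtD α → ℂ}
    (hf : f ∈ bergmanSpace (reinhardtD α)) (p : reinhardtD α) :
    f p = zeroExt _ f 0 + fderiv ℂ (zeroExt _ f) 0 p.1 := by
  obtain ⟨hd, hL⟩ := hf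
  set F := zeroExt (reinhardtD α) f with hF
  have hFm : Measurable F := measurable_zeroExt hd.continuousOn
  have hF2 : ∫⁻ p in (reinhardtD α : Set (Fin 2 → ℂ)), ‖F p‖ₑ ^ 2 < ⊤ := by
    have := lintegral_rpow_enorm_lt_top_of_eLpNorm_lt_top two_ne_zero ENNReal.ofNat_ne_top hL.2
    simpa using this
  have h0 := zero_mem_reinhardtD α
  have hd0 : DifferentiableAt ℂ F 0 := hd.differentiableAt ((reinhardtD α).isOpen.mem_nhds h0)
  have hbal : ∀ p ∈ reinhardtD α, ∀ c : ℂ, ‖c‖ ≤ 1 → c • p ∈ reinhardtD α :=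
    fun p hp c hc => smul_mem_reinhardtD h₁ hp hc
  have hA : ∀ p ∈ reinhardtD α, p 0 ≠ 0 → F p = F 0 + fderiv ℂ F 0 p := by
    intro p hp hp0
    have hs := differentiableOn_slice hd hbal hp
    have hball : ∀ t ∈ Metric.ball (0 : ℂ) 1, F (t • p) = F 0 + t * fderiv ℂ F 0 p := by
      intro t ht
      rw [← Complex.taylorSeries_eq_on_ball' ht (hs.mono Metric.ball_subset_closedBall),
        tsum_eq_sum (s := Finset.range 2), Finset.sum_range_succ, Finset.sum_range_one]
      · have h1 := homogeneousPart_one hd0 p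
        rw [homogeneousPart] at h1
        rw [h1]
        simp [mul_comm]
      · intro k hk
        have h2 := homogeneousPart_eq_zero h₁ h₃ hFm hd hF2 (k := k)
          (by simpa [Nat.succ_le_iff] using hk) hp0
        rw [homogeneousPart] at h2
        rw [h2, zero_mul]
    -- The point `p` itself sits at `t = 1`, on the boundary of the disc of convergence, and is
    -- reached by continuity.
    have hcl : Set.EqOn (fun t : ℂ => F (t • p)) (fun t => F 0 + t * fderiv ℂ F 0 p)
        (Metric.closedBall 0 1) := by
      have hb : Set.EqOn (fun t : ℂ => F (t • p)) (fun t => F 0 + t * fderiv ℂ F 0 p)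
        (Metric.ball 0 1) := hball
      exact hb.of_subset_closure hs.continuousOn (by fun_prop) Metric.ball_subset_closedBall
        (closure_ball (0 : ℂ) one_ne_zero).ge
    simpa using hcl (by simp : (1 : ℂ) ∈ Metric.closedBall (0 : ℂ) 1)
  -- The excluded points `p 0 = 0` form a null set, and both sides are continuous.
  have hE : Set.EqOn F (fun p => F 0 + fderiv ℂ F 0 p) (reinhardtD α) := by
    refine Measure.eqOn_open_of_ae_eq (μ := volume) ?_ (reinhardtD α).isOpen hd.continuousOn
      (by fun_prop)
    refine (ae_restrict_iff' (reinhardtD α).isOpen.measurableSet).2 ?_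
    filter_upwards [ae_coord_ne_zero 0] with p hp0 hp
    exact hA p hp hp0
  have := hE p.2
  rwa [hF, zeroExt_of_mem _ f p.2] at this

theorem mem_bergmanSpace_of_norm_sq_le {α : ℝ} (h₂ : 2 < α) {g : (Fin 2 → ℂ) → ℂ}
    (hg : Differentiable ℂ g) (hle : ∀ p, ‖g p‖ ^ 2 ≤ 1 + ‖p 0‖ ^ 2 + ‖p 1‖ ^ 2) :
    (fun p : reinhardtD α => g p.1) ∈ bergmanSpace (reinhardtD α) := by
  have he : Set.EqOn (zeroExt (reinhardtD α) fun p : reinhardtD α => g p.1) g (reinhardtD α) :=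
    fun p hp => zeroExt_of_mem _ _ hp
  have hDm : MeasurableSet (reinhardtD α : Set (Fin 2 → ℂ)) := (reinhardtD α).isOpen.measurableSet
  refine ⟨hg.differentiableOn.congr he, ?_⟩
  have hL : MemLp g 2 (volume.restrict (reinhardtD α : Set (Fin 2 → ℂ))) := by
    rw [memLp_two_iff_integrable_sq_norm hg.continuous.aestronglyMeasurable]
    refine ⟨(hg.continuous.norm.pow 2).aestronglyMeasurable, ?_⟩
    rw [hasFiniteIntegral_iff_ofReal (Filter.Eventually.of_forall fun _ => by positivity)]
    exact (lintegral_mono fun p => ENNReal.ofReal_le_ofReal (hle p)).trans_lt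
      (lintegral_one_add_norm_sq_lt_top h₂)
  exact hL.ae_eq ((ae_restrict_iff' hDm).2 (Filter.Eventually.of_forall fun p hp => (he hp).symm))

theorem bergmanSpace_reinhardtD {α : ℝ} (h₂ : 2 < α) (h₃ : α < 3) :
    bergmanSpace (reinhardtD α) =
      Submodule.span ℂ {fun _ => 1, fun p => p.1 0, fun p => p.1 1} := by
  apply le_antisymm
  · intro f hf
    have hlin : ∀ p : Fin 2 → ℂ, fderiv ℂ (zeroExt (reinhardtD α) f) 0 p =
        p 0 * fderiv ℂ (zeroExt (reinhardtD α) f) 0 (Pi.single 0 1) +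
        p 1 * fderiv ℂ (zeroExt (reinhardtD α) f) 0 (Pi.single 1 1) := by
      intro p
      rw [← smul_eq_mul, ← smul_eq_mul, ← map_smul, ← map_smul, ← map_add]
      congr 1
      funext j
      fin_cases j <;> simp
    rw [Submodule.mem_span_triple]
    refine ⟨zeroExt (reinhardtD α) f 0, fderiv ℂ (zeroExt (reinhardtD α) f) 0 (Pi.single 0 1),
      fderiv ℂ (zeroExt (reinhardtD α) f) 0 (Pi.single 1 1), ?_⟩
    funext p
    rw [eq_affine_of_mem_bergmanSpace (by linarith) h₃ hf p, hlin p.1]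
    simp only [Pi.add_apply, Pi.smul_apply, smul_eq_mul]
    ring
  · rw [Submodule.span_le]
    rintro f (rfl | rfl | rfl)
    · exact mem_bergmanSpace_of_norm_sq_le h₂ (g := fun _ => 1) (by fun_prop)
        (fun p => by simp only [norm_one]; nlinarith [sq_nonneg ‖p 0‖, sq_nonneg ‖p 1‖])
    · exact mem_bergmanSpace_of_norm_sq_le h₂ (g := fun p => p 0) (by fun_prop)
        (fun p => by nlinarith [sq_nonneg ‖p 0‖, sq_nonneg ‖p 1‖])
    · exact mem_bergmanSpace_of_norm_sq_le h₂ (g := fun p => p 1) (by fun_prop)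
        (fun p => by nlinarith [sq_nonneg ‖p 0‖, sq_nonneg ‖p 1‖])

/-! ### The Bergman kernel in terms of a finite orthogonal family -/

section

variable {n : ℕ} {Ω : Opens (Fin n → ℂ)}

theorem integrable_mul_conj_of_mem_bergmanSpace {f g : Ω → ℂ} (hf : f ∈ bergmanSpace Ω)
    (hg : g ∈ bergmanSpace Ω) :
    Integrable (fun z => zeroExt Ω f z * conj (zeroExt Ω g z))
      (volume.restrict (Ω : Set (Fin n → ℂ))) :=
  hf.2.integrable_mul hg.2.star

theorem bergmanInner_add_left {f g h : Ω → ℂ} (hf : f ∈ bergmanSpace Ω) (hg : g ∈ bergmanSpace Ω)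
    (hh : h ∈ bergmanSpace Ω) :
    bergmanInner Ω (f + g) h = bergmanInner Ω f h + bergmanInner Ω g h := by
  rw [bergmanInner, bergmanInner, bergmanInner, ← integral_add
    (integrable_mul_conj_of_mem_bergmanSpace hf hh) (integrable_mul_conj_of_mem_bergmanSpace hg hh)]
  simp only [zeroExt_add, Pi.add_apply, add_mul]

theorem bergmanInner_zero_left (h : Ω → ℂ) : bergmanInner Ω 0 h = 0 := by
  simp [bergmanInner, zeroExt_zero]

theorem bergmanInner_sum_left {ι : Type*} (s : Finset ι) {e : ι → Ω → ℂ} (a : ι → ℂ)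
    (he : ∀ i, e i ∈ bergmanSpace Ω) {h : Ω → ℂ} (hh : h ∈ bergmanSpace Ω) :
    bergmanInner Ω (∑ i ∈ s, a i • e i) h = ∑ i ∈ s, a i * bergmanInner Ω (e i) h := by
  classical
  induction s using Finset.induction_on with
  | empty => simp [bergmanInner_zero_left]
  | insert i s hi ih =>
    rw [Finset.sum_insert hi, Finset.sum_insert hi, bergmanInner_add_left
      ((bergmanSpace Ω).smul_mem _ (he i))
      ((bergmanSpace Ω).sum_mem fun j _ => (bergmanSpace Ω).smul_mem _ (he j)) hh,
      bergmanInner_smul_left, ih]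

/-- The kernel is defined through a chosen basis, so this is independence of the basis. The
orthonormal family identifies `A²(Ω)` with a Euclidean space in which the chosen basis becomes a
Hilbert basis; Parseval for the vector representing evaluation at `p` gives the sum. -/
theorem bergmanKernel_eq_sum {ι : Type*} [Fintype ι] [DecidableEq ι] {e : ι → Ω → ℂ}
    (he : ∀ i, e i ∈ bergmanSpace Ω)
    (horth : ∀ i j, bergmanInner Ω (e i) (e j) = if i = j then 1 else 0)
    (hspan : bergmanSpace Ω ≤ Submodule.span ℂ (Set.range e)) {p : Fin n → ℂ} (hp : p ∈ Ω) :
    bergmanKernel Ω p = ∑ i, ‖e i ⟨p, hp⟩‖ ^ 2 := by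
  set T : EuclideanSpace ℂ ι → Ω → ℂ := fun a => ∑ i, a i • e i with hT
  have hTm : ∀ a, T a ∈ bergmanSpace Ω := fun a =>
    (bergmanSpace Ω).sum_mem fun j _ => (bergmanSpace Ω).smul_mem _ (he j)
  -- The arguments swap because `bergmanInner` is linear in its first slot and `inner` in its
  -- second.
  have hTi : ∀ a b, bergmanInner Ω (T a) (T b) = inner ℂ b a := by
    intro a b
    rw [hT]
    simp only
    rw [bergmanInner_sum_left _ _ he (hTm b), PiLp.inner_apply]
    refine Finset.sum_congr rfl fun i _ => ?_
    rw [bergmanInner_conj, hT]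
    simp only
    rw [bergmanInner_sum_left _ _ he (he i)]
    simp [horth, mul_comm]
  have hB := bergmanBasis_spec Ω
  have hex : ∀ φ : bergmanBasis Ω, ∃ a, T a = φ := by
    intro φ
    obtain ⟨a, ha⟩ := (Submodule.mem_span_range_iff_exists_fun ℂ).1 (hspan (hB.subset φ.2))
    exact ⟨WithLp.toLp 2 a, by simpa [hT] using ha⟩
  choose v hv using hex
  have hvo : Orthonormal ℂ v := by
    classical
    rw [orthonormal_iff_ite]
    intro φ ψ
    rw [← hTi, hv, hv]
    split_ifs with h
    · rw [h]; exact hB.norm_one _ ψ.2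
    · exact hB.orthogonal _ ψ.2 _ φ.2 fun h' => h (Subtype.ext h'.symm)
  have hvt : (Submodule.span ℂ (Set.range v))ᗮ = ⊥ := by
    rw [eq_bot_iff]
    intro x hx
    have h0 : T x = 0 := hB.total _ (hTm x) fun φ hφ => by
      have := hTi x (v ⟨φ, hφ⟩)
      rw [hv] at this
      rw [this]
      exact (Submodule.mem_orthogonal _ _).1 hx _ (Submodule.subset_span ⟨_, rfl⟩)
    have h1 := hTi x x
    rw [h0, bergmanInner_zero_left] at h1
    exact (Submodule.mem_bot ℂ).2 (inner_self_eq_zero.1 h1.symm)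
  set b := HilbertBasis.mkOfOrthogonalEqBot hvo hvt with hb
  set x : EuclideanSpace ℂ ι := WithLp.toLp 2 fun i => conj (e i ⟨p, hp⟩) with hx
  have hin : ∀ φ : bergmanBasis Ω, inner ℂ x (b φ) = zeroExt Ω (φ : Ω → ℂ) p := by
    intro φ
    rw [zeroExt_of_mem Ω _ hp, ← hv φ, hb, HilbertBasis.coe_mkOfOrthogonalEqBot, PiLp.inner_apply,
      hT]
    simp [hx, Finset.sum_apply]
  have hs := b.hasSum_inner_mul_inner x x
  have hterm : ∀ φ, inner ℂ x (b φ) * inner ℂ (b φ) x =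
      ((‖zeroExt Ω (φ : Ω → ℂ) p‖ ^ 2 : ℝ) : ℂ) := by
    intro φ
    rw [← inner_conj_symm (b φ) x, hin, Complex.mul_conj, Complex.normSq_eq_norm_sq]
  simp_rw [hterm] at hs
  have hxx : inner ℂ x x = ((∑ i, ‖e i ⟨p, hp⟩‖ ^ 2 : ℝ) : ℂ) := by
    rw [inner_self_eq_norm_sq_to_K, EuclideanSpace.norm_eq, ← Complex.coe_algebraMap, ← map_pow,
      Real.sq_sqrt (by positivity)]
    simp [hx]
  rw [hxx] at hs
  exact (Complex.hasSum_ofReal.1 hs).tsum_eq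

/-- Normalising gives `c i = 1 / ‖m i‖²`; only positivity is recorded, since nothing later depends
on the values. -/
theorem exists_bergmanKernel_eq_sum {ι : Type*} [Fintype ι] {m : ι → Ω → ℂ}
    (hm : ∀ i, m i ∈ bergmanSpace Ω) (hne : ∀ i, m i ≠ 0)
    (horth : ∀ i j, i ≠ j → bergmanInner Ω (m i) (m j) = 0)
    (hspan : bergmanSpace Ω ≤ Submodule.span ℂ (Set.range m)) :
    ∃ c : ι → ℝ, (∀ i, 0 < c i) ∧ ∀ p : Ω, bergmanKernel Ω p = ∑ i, c i * ‖m i p‖ ^ 2 := by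
  classical
  set N : ι → ℝ := fun i => ∫ z in (Ω : Set (Fin n → ℂ)), ‖zeroExt Ω (m i) z‖ ^ 2 with hN
  have hNpos : ∀ i, 0 < N i := by
    intro i
    refine lt_of_le_of_ne (integral_nonneg fun _ => by positivity) fun h0 => hne i ?_
    refine eq_zero_of_bergmanInner_self Ω (hm i) ?_
    rw [bergmanInner_self]
    exact_mod_cast h0.symm
  set s : ι → ℂ := fun i => (((√(N i))⁻¹ : ℝ) : ℂ) with hs
  have hs0 : ∀ i, s i ≠ 0 := fun i => by
    simp only [hs, ne_eq, Complex.ofReal_eq_zero, inv_eq_zero]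
    exact (Real.sqrt_pos.2 (hNpos i)).ne'
  refine ⟨fun i => (N i)⁻¹, fun i => inv_pos.2 (hNpos i), fun p => ?_⟩
  rw [bergmanKernel_eq_sum (e := fun i => s i • m i) (fun i => (bergmanSpace Ω).smul_mem _ (hm i))
    ?_ ?_ p.2]
  · refine Finset.sum_congr rfl fun i _ => ?_
    rw [Pi.smul_apply, smul_eq_mul, norm_mul, mul_pow, hs]
    simp [inv_pow, Real.sq_sqrt (hNpos i).le]
  · intro i j
    rw [bergmanInner_smul_left, bergmanInner_conj, bergmanInner_smul_left]
    split_ifs with h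
    · subst h
      rw [bergmanInner_self, map_mul, Complex.conj_ofReal, hs]
      simp only
      rw [Complex.conj_ofReal]
      norm_cast
      rw [← mul_assoc, ← mul_inv, Real.mul_self_sqrt (hNpos i).le]
      exact inv_mul_cancel₀ (hNpos i).ne'
    · rw [horth j i (Ne.symm h)]; simp
  · refine hspan.trans (Submodule.span_le.2 ?_)
    rintro _ ⟨i, rfl⟩
    have : m i = (s i)⁻¹ • (s i • m i) := by rw [smul_smul, inv_mul_cancel₀ (hs0 i), one_smul]
    rw [this]
    exact Submodule.smul_mem _ _ (Submodule.subset_span ⟨i, rfl⟩)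

/-- Functions with different characters under a rotation are orthogonal. -/
theorem bergmanInner_eq_zero_of_rotation (hΩ : IsReinhardt Ω) {f g : Ω → ℂ} {c : Fin n → ℂ}
    (hc : ∀ j, ‖c j‖ = 1) {a : ℂ} (ha : a ≠ 1)
    (h : ∀ p ∈ Ω, zeroExt Ω f (c * p) * conj (zeroExt Ω g (c * p)) =
      a * (zeroExt Ω f p * conj (zeroExt Ω g p))) :
    bergmanInner Ω f g = 0 := by
  have hpre : (fun p : Fin n → ℂ => c * p) ⁻¹' Ω = Ω := by
    ext p
    refine ⟨fun hp => ?_, fun hp => hΩ p hp c hc⟩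
    have h1 := hΩ _ hp (fun j => (c j)⁻¹) (fun j => by simp [hc j])
    have h2 : (fun j => (c j)⁻¹) * (c * p) = p := by
      funext j
      have : c j ≠ 0 := fun h0 => by simpa [h0] using hc j
      simp [this]
    rwa [h2] at h1
  have hcn : ∀ j, c j ≠ 0 := fun j h0 => by simpa [h0] using hc j
  have hemb : MeasurableEmbedding fun p : Fin n → ℂ => c * p := by
    have := (MeasurableEquiv.piCongrRight fun j : Fin n =>
      (Homeomorph.mulLeft₀ (c j) (hcn j)).toMeasurableEquiv).measurableEmbedding
    exact this
  have h1 := (volume_preserving_mul_left_of_norm_eq_one hc).setIntegral_preimage_emb hemb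
    (fun p => zeroExt Ω f p * conj (zeroExt Ω g p)) (Ω : Set (Fin n → ℂ))
  rw [hpre, setIntegral_congr_fun Ω.isOpen.measurableSet h, integral_const_mul] at h1
  have h2 : (a - 1) * bergmanInner Ω f g = 0 := by
    rw [sub_mul, one_mul, bergmanInner, h1, sub_self]
  exact (mul_eq_zero.1 h2).resolve_left (sub_ne_zero.2 ha)

end

/-! ### The kernel of `D(α)` up to positive constants -/

theorem exists_bergmanKernel_reinhardtD {α : ℝ} (h₂ : 2 < α) (h₃ : α < 3) :
    ∃ (c₀ : ℝ) (c : Fin 2 → ℝ), 0 < c₀ ∧ (∀ j, 0 < c j) ∧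
      ∀ p ∈ reinhardtD α, bergmanKernel (reinhardtD α) p = c₀ + ∑ j, c j * ‖p j‖ ^ 2 := by
  set m : Fin 3 → reinhardtD α → ℂ := ![fun _ => 1, fun p => p.1 0, fun p => p.1 1] with hm
  have hrange : Set.range m = {fun _ => 1, fun p => p.1 0, fun p => p.1 1} := by
    rw [hm]
    ext f
    simp only [Matrix.range_cons, Matrix.range_empty, Set.union_empty, Set.mem_union,
      Set.mem_singleton_iff, Set.mem_insert_iff]
  have hspan := bergmanSpace_reinhardtD h₂ h₃
  rw [← hrange] at hspan
  have hmem : ∀ i, m i ∈ bergmanSpace (reinhardtD α) := fun i => by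
    rw [hspan]; exact Submodule.subset_span ⟨i, rfl⟩
  have hne : ∀ i, m i ≠ 0 := by
    intro i h
    have := congrFun h ⟨fun _ => 1, diagonal_mem_reinhardtD α rfl⟩
    fin_cases i <;> simp [hm] at this
  have hR := isReinhardt_reinhardtD α
  have horth : ∀ i j, i < j → bergmanInner (reinhardtD α) (m i) (m j) = 0 := by
    intro i j hij
    -- For `i < j`, flip the sign of the coordinate that `m j` reads: `m j` changes sign and `m i`
    -- does not.
    set c : Fin 2 → ℂ := if j = 1 then ![-1, 1] else ![1, -1] with hc
    have hcn : ∀ l, ‖c l‖ = 1 := by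
      intro l
      rw [hc]
      split_ifs <;> fin_cases l <;> simp
    refine bergmanInner_eq_zero_of_rotation hR hcn (a := -1) (by norm_num) fun p hp => ?_
    rw [zeroExt_of_mem _ _ hp, zeroExt_of_mem _ _ hp, zeroExt_of_mem _ _ (hR p hp c hcn),
      zeroExt_of_mem _ _ (hR p hp c hcn)]
    fin_cases i <;> fin_cases j <;> simp_all
  have horth' : ∀ i j, i ≠ j → bergmanInner (reinhardtD α) (m i) (m j) = 0 := by
    intro i j hij
    rcases lt_or_gt_of_ne hij with h | h
    · exact horth i j h
    · rw [bergmanInner_conj, horth j i h, map_zero]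
  obtain ⟨c, hc, hK⟩ := exists_bergmanKernel_eq_sum hmem hne horth' hspan.le
  refine ⟨c 0, ![c 1, c 2], hc 0, fun j => by fin_cases j <;> simp [hc], fun p hp => ?_⟩
  rw [hK ⟨p, hp⟩, Fin.sum_univ_three, Fin.sum_univ_two]
  simp [hm]
  ring

/-! ### Wirtinger calculus -/

section Wirtinger

variable {n : ℕ}

/-- `F` is real differentiable at `p` and `(∂F/∂xⱼ + ε ∂F/∂yⱼ) / 2 = d`; the values `ε = ∓i`
correspond to the two Wirtinger derivatives. -/
def HasWirtinger (ε : ℂ) (j : Fin n) (F : (Fin n → ℂ) → ℂ) (d : ℂ) (p : Fin n → ℂ) : Prop :=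
  ∃ L : (Fin n → ℂ) →L[ℝ] ℂ, HasFDerivAt F L p ∧
    (L (Pi.single j 1) + ε * L (Pi.single j Complex.I)) / 2 = d

variable {ε : ℂ} {j : Fin n} {F G : (Fin n → ℂ) → ℂ} {d e : ℂ} {p : Fin n → ℂ}

theorem HasWirtinger.wirtinger_eq (h : HasWirtinger (-Complex.I) j F d p) :
    wirtinger j F p = d := by
  obtain ⟨L, hL, rfl⟩ := h
  rw [wirtinger, hL.fderiv, neg_mul, ← sub_eq_add_neg]

theorem HasWirtinger.wirtingerBar_eq (h : HasWirtinger Complex.I j F d p) :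
    wirtingerBar j F p = d := by
  obtain ⟨L, hL, rfl⟩ := h
  rw [wirtingerBar, hL.fderiv]

theorem HasWirtinger.congr_deriv (h : HasWirtinger ε j F d p) (he : d = e) :
    HasWirtinger ε j F e p := he ▸ h

theorem hasWirtinger_const (c : ℂ) : HasWirtinger ε j (fun _ => c) 0 p :=
  ⟨0, hasFDerivAt_const c p, by simp⟩

theorem HasWirtinger.add (hF : HasWirtinger ε j F d p) (hG : HasWirtinger ε j G e p) :
    HasWirtinger ε j (fun z => F z + G z) (d + e) p := by
  obtain ⟨L, hL, rfl⟩ := hF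
  obtain ⟨M, hM, rfl⟩ := hG
  exact ⟨L + M, hL.add hM, by simp only [add_apply]; ring⟩

theorem HasWirtinger.mul (hF : HasWirtinger ε j F d p) (hG : HasWirtinger ε j G e p) :
    HasWirtinger ε j (fun z => F z * G z) (F p * e + G p * d) p := by
  obtain ⟨L, hL, rfl⟩ := hF
  obtain ⟨M, hM, rfl⟩ := hG
  refine ⟨_, hL.mul hM, ?_⟩
  simp only [add_apply, smul_apply, smul_eq_mul]
  ring

theorem HasWirtinger.const_mul (c : ℂ) (hF : HasWirtinger ε j F d p) :
    HasWirtinger ε j (fun z => c * F z) (c * d) p :=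
  ((hasWirtinger_const c).mul hF).congr_deriv (by ring)

theorem HasWirtinger.sum {ι : Type*} (s : Finset ι) {F : ι → (Fin n → ℂ) → ℂ} {d : ι → ℂ}
    (h : ∀ i ∈ s, HasWirtinger ε j (F i) (d i) p) :
    HasWirtinger ε j (fun z => ∑ i ∈ s, F i z) (∑ i ∈ s, d i) p := by
  classical
  induction s using Finset.induction_on with
  | empty => simpa using hasWirtinger_const 0
  | insert i s hi ih =>
    simp only [Finset.sum_insert hi]
    exact (h i (Finset.mem_insert_self _ _)).add
      (ih fun k hk => h k (Finset.mem_insert_of_mem hk))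

theorem HasWirtinger.inv (hF : HasWirtinger ε j F d p) (h0 : F p ≠ 0) :
    HasWirtinger ε j (fun z => (F z)⁻¹) (-d * ((F p)⁻¹) ^ 2) p := by
  obtain ⟨L, hL, rfl⟩ := hF
  have h := ((hasDerivAt_inv h0).hasFDerivAt.restrictScalars ℝ).comp p hL
  refine ⟨_, h, ?_⟩
  simp only [ContinuousLinearMap.comp_apply, ContinuousLinearMap.coe_restrictScalars',
    ContinuousLinearMap.toSpanSingleton_apply, smul_eq_mul]
  field_simp
  ring

theorem hasWirtinger_coord (i : Fin n) :
    HasWirtinger ε j (fun z => z i) (if i = j then (1 + ε * Complex.I) / 2 else 0) p := by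
  refine ⟨ContinuousLinearMap.proj i, hasFDerivAt_apply i p, ?_⟩
  by_cases h : i = j
  · subst h; simp
  · simp [h]

theorem hasWirtinger_conj_coord (i : Fin n) :
    HasWirtinger ε j (fun z => conj (z i)) (if i = j then (1 - ε * Complex.I) / 2 else 0) p := by
  refine ⟨(Complex.conjCLE : ℂ →L[ℝ] ℂ).comp (ContinuousLinearMap.proj i),
    (Complex.conjCLE : ℂ →L[ℝ] ℂ).hasFDerivAt.comp p (hasFDerivAt_apply i p), ?_⟩
  by_cases h : i = j
  · subst h; simp [sub_eq_add_neg]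
  · simp [h]

theorem HasWirtinger.log {N : (Fin n → ℂ) → ℝ} (hN : DifferentiableAt ℝ N p) (h0 : N p ≠ 0)
    (h : HasWirtinger ε j (fun z => (N z : ℂ)) d p) :
    HasWirtinger ε j (fun z => (Real.log (N z) : ℂ)) (d * ((N p : ℂ))⁻¹) p := by
  obtain ⟨L, hL, rfl⟩ := h
  -- Uniqueness of the derivative shows that `L` takes real values, so the real chain rule for `log`
  -- applies.
  have hL' : L = Complex.ofRealCLM.comp (fderiv ℝ N p) :=
    hL.unique (Complex.ofRealCLM.hasFDerivAt.comp p hN.hasFDerivAt)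
  refine ⟨_, Complex.ofRealCLM.hasFDerivAt.comp p (hN.hasFDerivAt.log h0), ?_⟩
  subst hL'
  simp
  ring

theorem wirtinger_congr (h : F =ᶠ[nhds p] G) : wirtinger j F p = wirtinger j G p := by
  rw [wirtinger, wirtinger, h.fderiv_eq]

theorem wirtingerBar_congr (h : F =ᶠ[nhds p] G) : wirtingerBar j F p = wirtingerBar j G p := by
  rw [wirtingerBar, wirtingerBar, h.fderiv_eq]

end Wirtinger

/-! ### Metrics with potential `log (c₀ + ∑ cⱼ |zⱼ|²)` -/

section FubiniStudy

variable {n : ℕ} (c₀ : ℝ) (c : Fin n → ℝ)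

/-- The function `c₀ + ∑ cⱼ |zⱼ|²`. -/
def diagonalQuadratic (p : Fin n → ℂ) : ℝ := c₀ + ∑ j, c j * ‖p j‖ ^ 2

/-- The metric `∂∂̄ log (c₀ + ∑ cⱼ |zⱼ|²)`. -/
def fubiniStudy (p : Fin n → ℂ) : Matrix (Fin n) (Fin n) ℂ :=
  Matrix.of fun i j => (if i = j then (c i : ℂ) else 0) * (diagonalQuadratic c₀ c p : ℂ)⁻¹ +
    -(c i * conj (p i)) * (c j * p j) * ((diagonalQuadratic c₀ c p : ℂ)⁻¹) ^ 2

variable {c₀ c}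

theorem diagonalQuadratic_pos (h₀ : 0 < c₀) (hc : ∀ j, 0 < c j) (p : Fin n → ℂ) :
    0 < diagonalQuadratic c₀ c p :=
  add_pos_of_pos_of_nonneg h₀ (Finset.sum_nonneg fun j _ => mul_nonneg (hc j).le (sq_nonneg _))

theorem contDiff_diagonalQuadratic : ContDiff ℝ ∞ (diagonalQuadratic c₀ c) := by
  refine contDiff_const.add (ContDiff.sum fun j _ => contDiff_const.mul ?_)
  exact (contDiff_apply ℝ ℂ j).norm_sq ℝ

theorem ofReal_diagonalQuadratic (p : Fin n → ℂ) :
    (diagonalQuadratic c₀ c p : ℂ) = c₀ + ∑ j, c j * (p j * conj (p j)) := by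
  simp [diagonalQuadratic, Complex.mul_conj, Complex.normSq_eq_norm_sq]

theorem hasWirtinger_diagonalQuadratic (k : Fin n) (p : Fin n → ℂ) :
    HasWirtinger (-Complex.I) k (fun z => (diagonalQuadratic c₀ c z : ℂ)) (c k * conj (p k)) p := by
  simp_rw [ofReal_diagonalQuadratic]
  refine ((hasWirtinger_const _).add (HasWirtinger.sum _ fun i _ => HasWirtinger.const_mul _
    ((hasWirtinger_coord i).mul (hasWirtinger_conj_coord i)))).congr_deriv ?_
  simp

theorem hasWirtingerBar_diagonalQuadratic (k : Fin n) (p : Fin n → ℂ) :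
    HasWirtinger Complex.I k (fun z => (diagonalQuadratic c₀ c z : ℂ)) (c k * p k) p := by
  simp_rw [ofReal_diagonalQuadratic]
  refine ((hasWirtinger_const _).add (HasWirtinger.sum _ fun i _ => HasWirtinger.const_mul _
    ((hasWirtinger_coord i).mul (hasWirtinger_conj_coord i)))).congr_deriv ?_
  simp

theorem hasWirtinger_coord' (i k : Fin n) (p : Fin n → ℂ) :
    HasWirtinger (-Complex.I) k (fun z => z i) (if i = k then 1 else 0) p :=
  (hasWirtinger_coord i).congr_deriv (by simp)

theorem hasWirtingerBar_coord (i k : Fin n) (p : Fin n → ℂ) :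
    HasWirtinger Complex.I k (fun z => z i) 0 p :=
  (hasWirtinger_coord i).congr_deriv (by simp)

theorem hasWirtinger_conj_coord' (i k : Fin n) (p : Fin n → ℂ) :
    HasWirtinger (-Complex.I) k (fun z => conj (z i)) 0 p :=
  (hasWirtinger_conj_coord i).congr_deriv (by simp)

theorem hasWirtingerBar_conj_coord (i k : Fin n) (p : Fin n → ℂ) :
    HasWirtinger Complex.I k (fun z => conj (z i)) (if i = k then 1 else 0) p :=
  (hasWirtinger_conj_coord i).congr_deriv (by simp)

theorem wirtinger_wirtingerBar_log_diagonalQuadratic (h₀ : 0 < c₀) (hc : ∀ j, 0 < c j)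
    (i j : Fin n) (p : Fin n → ℂ) :
    wirtinger i (wirtingerBar j fun z => (Real.log (diagonalQuadratic c₀ c z) : ℂ)) p =
      fubiniStudy c₀ c p i j := by
  have h1 : (wirtingerBar j fun z => (Real.log (diagonalQuadratic c₀ c z) : ℂ)) =
      fun z => c j * z j * (diagonalQuadratic c₀ c z : ℂ)⁻¹ := by
    funext z
    exact (HasWirtinger.log (contDiff_diagonalQuadratic.differentiable (by simp)).differentiableAt
      (diagonalQuadratic_pos h₀ hc z).ne' (hasWirtingerBar_diagonalQuadratic j z)).wirtingerBar_eq
  rw [h1]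
  have hN : (diagonalQuadratic c₀ c p : ℂ) ≠ 0 := by
    exact_mod_cast (diagonalQuadratic_pos h₀ hc p).ne'
  rw [(((hasWirtinger_coord' j i p).const_mul (c j : ℂ)).mul
    ((hasWirtinger_diagonalQuadratic i p).inv hN)).wirtinger_eq]
  simp only [fubiniStudy, Matrix.of_apply]
  by_cases h : i = j
  · subst h
    simp only [if_true]
    ring
  · simp only [h, Ne.symm h, if_false]
    ring

/-- With `N` the quadratic function and `N_k = ∂_k N`, this reads `∂_k g_{i j̄} = -(N_k g_{i j̄} +
N_i g_{k j̄}) / N`. Writing derivatives of `g` through `g` itself reduces the curvature to algebra.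
-/
theorem hasWirtinger_fubiniStudy (h₀ : 0 < c₀) (hc : ∀ j, 0 < c j) (i j k : Fin n)
    (p : Fin n → ℂ) :
    HasWirtinger (-Complex.I) k (fun z => fubiniStudy c₀ c z i j)
      (-(diagonalQuadratic c₀ c p : ℂ)⁻¹ * (c k * conj (p k) * fubiniStudy c₀ c p i j +
        c i * conj (p i) * fubiniStudy c₀ c p k j)) p := by
  have hN : (diagonalQuadratic c₀ c p : ℂ) ≠ 0 := by
    exact_mod_cast (diagonalQuadratic_pos h₀ hc p).ne'
  have hI := (hasWirtinger_diagonalQuadratic (c₀ := c₀) (c := c) k p).inv hN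
  have h := (hI.const_mul (if i = j then (c i : ℂ) else 0)).add
    ((((((hasWirtinger_conj_coord' i k p).const_mul (c i : ℂ)).const_mul (-1))).mul
      ((hasWirtinger_coord' j k p).const_mul (c j : ℂ))).mul (hI.mul hI))
  have he : (fun z => fubiniStudy c₀ c z i j) = fun z =>
      (if i = j then (c i : ℂ) else 0) * (diagonalQuadratic c₀ c z : ℂ)⁻¹ +
      -1 * (c i * conj (z i)) * (c j * z j) *
        ((diagonalQuadratic c₀ c z : ℂ)⁻¹ * (diagonalQuadratic c₀ c z : ℂ)⁻¹) := by
    funext z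
    simp only [fubiniStudy, Matrix.of_apply]
    ring
  rw [he]
  refine h.congr_deriv ?_
  simp only [fubiniStudy, Matrix.of_apply]
  by_cases h : k = j
  · subst h
    simp only [if_true]
    ring
  · simp only [h, Ne.symm h, if_false]
    ring

theorem hasWirtingerBar_fubiniStudy (h₀ : 0 < c₀) (hc : ∀ j, 0 < c j) (i j l : Fin n)
    (p : Fin n → ℂ) :
    HasWirtinger Complex.I l (fun z => fubiniStudy c₀ c z i j)
      (-(diagonalQuadratic c₀ c p : ℂ)⁻¹ * (c l * p l * fubiniStudy c₀ c p i j +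
        c j * p j * fubiniStudy c₀ c p i l)) p := by
  have hN : (diagonalQuadratic c₀ c p : ℂ) ≠ 0 := by
    exact_mod_cast (diagonalQuadratic_pos h₀ hc p).ne'
  have hI := (hasWirtingerBar_diagonalQuadratic (c₀ := c₀) (c := c) l p).inv hN
  have h := (hI.const_mul (if i = j then (c i : ℂ) else 0)).add
    ((((((hasWirtingerBar_conj_coord i l p).const_mul (c i : ℂ)).const_mul (-1))).mul
      ((hasWirtingerBar_coord j l p).const_mul (c j : ℂ))).mul (hI.mul hI))
  have he : (fun z => fubiniStudy c₀ c z i j) = fun z =>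
      (if i = j then (c i : ℂ) else 0) * (diagonalQuadratic c₀ c z : ℂ)⁻¹ +
      -1 * (c i * conj (z i)) * (c j * z j) *
        ((diagonalQuadratic c₀ c z : ℂ)⁻¹ * (diagonalQuadratic c₀ c z : ℂ)⁻¹) := by
    funext z
    simp only [fubiniStudy, Matrix.of_apply]
    ring
  rw [he]
  refine h.congr_deriv ?_
  simp only [fubiniStudy, Matrix.of_apply]
  by_cases h : i = l
  · subst h
    simp only [if_true]
    ring
  · simp only [h, if_false]
    ring

theorem fubiniStudy_isHermitian (p : Fin n → ℂ) : (fubiniStudy c₀ c p).IsHermitian := by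
  ext i j
  simp only [Matrix.conjTranspose_apply, fubiniStudy, Matrix.of_apply]
  by_cases h : i = j
  · subst h
    simp only [if_true, star_add, star_mul', star_pow, star_inv₀, star_neg, Complex.star_def,
      Complex.conj_ofReal, Complex.conj_conj]
    ring
  · simp only [h, Ne.symm h, if_false, star_add, star_mul', star_pow, star_inv₀, star_neg,
      Complex.star_def, Complex.conj_ofReal, Complex.conj_conj, star_zero, zero_mul]
    ring

theorem fubiniStudy_quadraticForm (h₀ : 0 < c₀) (hc : ∀ j, 0 < c j) (p X : Fin n → ℂ) :
    ∑ i, ∑ j, fubiniStudy c₀ c p i j * X i * conj (X j) =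
      (((diagonalQuadratic c₀ c p)⁻¹ ^ 2 * (diagonalQuadratic c₀ c p * ∑ i, c i * ‖X i‖ ^ 2 -
        ‖∑ i, c i * conj (p i) * X i‖ ^ 2) : ℝ) : ℂ) := by
  have hN : (diagonalQuadratic c₀ c p : ℂ) ≠ 0 := by
    exact_mod_cast (diagonalQuadratic_pos h₀ hc p).ne'
  set h : ℂ := (diagonalQuadratic c₀ c p : ℂ)⁻¹ with hh
  have h1 : ∑ i, ∑ j, fubiniStudy c₀ c p i j * X i * conj (X j) =
      h * ∑ i, c i * (X i * conj (X i)) -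
        h ^ 2 * ((∑ i, c i * conj (p i) * X i) * ∑ j, c j * p j * conj (X j)) := by
    rw [Finset.sum_mul_sum, Finset.mul_sum, Finset.mul_sum, ← Finset.sum_sub_distrib]
    refine Finset.sum_congr rfl fun i _ => ?_
    simp only [fubiniStudy, Matrix.of_apply, ← hh, add_mul, Finset.sum_add_distrib]
    rw [sub_eq_add_neg]
    congr 1
    · simp
      ring
    · rw [Finset.mul_sum, ← Finset.sum_neg_distrib]
      exact Finset.sum_congr rfl fun j _ => by ring
  have h2 : ∑ j, c j * p j * conj (X j) = conj (∑ i, c i * conj (p i) * X i) := by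
    simp
  rw [h1, h2, Complex.mul_conj, Complex.normSq_eq_norm_sq]
  push_cast
  simp only [Complex.mul_conj, Complex.normSq_eq_norm_sq, ← hh]
  push_cast
  rw [mul_sub, ← mul_assoc, sq h, mul_assoc h h (diagonalQuadratic c₀ c p : ℂ), hh,
    inv_mul_cancel₀ hN, mul_one]

/-- Cauchy–Schwarz with weights `c i` absorbs the subtracted square, and the strict gain is `c₀ ∑ c
i ‖X i‖²`. -/
theorem fubiniStudy_quadraticForm_pos (h₀ : 0 < c₀) (hc : ∀ j, 0 < c j) (p : Fin n → ℂ)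
    {X : Fin n → ℂ} (hX : X ≠ 0) : 0 < ∑ i, ∑ j, fubiniStudy c₀ c p i j * X i * conj (X j) := by
  rw [fubiniStudy_quadraticForm h₀ hc]
  obtain ⟨k, hk⟩ := Function.ne_iff.1 hX
  have hQ : 0 < ∑ i, c i * ‖X i‖ ^ 2 := by
    refine Finset.sum_pos' (fun i _ => mul_nonneg (hc i).le (sq_nonneg _)) ⟨k, Finset.mem_univ k, ?_⟩
    exact mul_pos (hc k) (pow_pos (norm_pos_iff.2 hk) 2)
  have hCS : ‖∑ i, c i * conj (p i) * X i‖ ^ 2 ≤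
      (∑ i, c i * ‖p i‖ ^ 2) * ∑ i, c i * ‖X i‖ ^ 2 := by
    have h1 : ‖∑ i, c i * conj (p i) * X i‖ ≤ ∑ i, (√(c i) * ‖p i‖) * (√(c i) * ‖X i‖) := by
      refine (norm_sum_le _ _).trans (Finset.sum_le_sum fun i _ => le_of_eq ?_)
      rw [norm_mul, norm_mul, Complex.norm_real, RCLike.norm_conj, Real.norm_of_nonneg (hc i).le]
      nth_rewrite 1 [← Real.mul_self_sqrt (hc i).le]
      ring
    calc ‖∑ i, c i * conj (p i) * X i‖ ^ 2
        ≤ (∑ i, (√(c i) * ‖p i‖) * (√(c i) * ‖X i‖)) ^ 2 := by gcongr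
      _ ≤ (∑ i, (√(c i) * ‖p i‖) ^ 2) * ∑ i, (√(c i) * ‖X i‖) ^ 2 :=
          Finset.sum_mul_sq_le_sq_mul_sq _ _ _
      _ = _ := by simp only [mul_pow, Real.sq_sqrt (hc _).le]
  have hN := diagonalQuadratic_pos h₀ hc p
  have hpos : 0 < diagonalQuadratic c₀ c p * ∑ i, c i * ‖X i‖ ^ 2 -
      ‖∑ i, c i * conj (p i) * X i‖ ^ 2 := by
    rw [diagonalQuadratic, add_mul]
    linarith [mul_pos h₀ hQ]
  exact_mod_cast (mul_pos (pow_pos (inv_pos.2 hN) 2) hpos)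

theorem fubiniStudy_posDef (h₀ : 0 < c₀) (hc : ∀ j, 0 < c j) (p : Fin n → ℂ) :
    (fubiniStudy c₀ c p).PosDef := by
  rw [Matrix.posDef_iff_dotProduct_mulVec]
  refine ⟨fubiniStudy_isHermitian p, fun x hx => ?_⟩
  -- `PosDef` conjugates the vector on the row index, the Hermitian form here on the column index,
  -- hence `star x`.
  have h := fubiniStudy_quadraticForm_pos h₀ hc p (X := star x) (star_ne_zero.2 hx)
  convert h using 1
  simp only [dotProduct, Matrix.mulVec, Finset.mul_sum, Pi.star_apply, Complex.star_def,
    Complex.conj_conj]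
  exact Finset.sum_congr rfl fun i _ => Finset.sum_congr rfl fun j _ => by ring

/-- The first derivatives of `g` are linear in `g`, so the inverse metric contracts away through `g
g⁻¹ g = g`. What remains is cancelled by the second derivative, except for the terms where `∂_k`
hits `N_{l̄}` or `N_{j̄}`. Those contribute `∂_k N_{l̄} / N = g_{k l̄} + N_k N_{l̄} / N²` and its
analogue for `j`. -/
theorem kahlerCurvature_fubiniStudy (h₀ : 0 < c₀) (hc : ∀ j, 0 < c j) (p : Fin n → ℂ)
    (i j k l : Fin n) :
    kahlerCurvature (fubiniStudy c₀ c) p i j k l =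
      fubiniStudy c₀ c p i j * fubiniStudy c₀ c p k l +
        fubiniStudy c₀ c p k j * fubiniStudy c₀ c p i l := by
  set g := fubiniStudy c₀ c p with hg
  have hN : (diagonalQuadratic c₀ c p : ℂ) ≠ 0 := by
    exact_mod_cast (diagonalQuadratic_pos h₀ hc p).ne'
  have hI := ((hasWirtinger_diagonalQuadratic (c₀ := c₀) (c := c) k p).inv hN).const_mul (-1)
  have hbar : (wirtingerBar l fun z => fubiniStudy c₀ c z i j) = fun z =>
      -1 * (diagonalQuadratic c₀ c z : ℂ)⁻¹ * (c l * z l * fubiniStudy c₀ c z i j +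
        c j * z j * fubiniStudy c₀ c z i l) := by
    funext z
    rw [(hasWirtingerBar_fubiniStudy h₀ hc i j l z).wirtingerBar_eq, neg_one_mul]
  have h2 := (hI.mul ((((hasWirtinger_coord' l k p).const_mul (c l : ℂ)).mul
    (hasWirtinger_fubiniStudy h₀ hc i j k p)).add
    (((hasWirtinger_coord' j k p).const_mul (c j : ℂ)).mul
    (hasWirtinger_fubiniStudy h₀ hc i l k p)))).wirtinger_eq
  have hS : ∀ i j, ∑ a, ∑ b, g i b * g⁻¹ b a * g a j = g i j := by
    intro i j
    have hdet : IsUnit g.det := (Matrix.isUnit_iff_isUnit_det _).1 (fubiniStudy_posDef h₀ hc p).isUnit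
    have : (g * g⁻¹ * g) i j = g i j := by rw [Matrix.mul_nonsing_inv g hdet, Matrix.one_mul]
    rw [Matrix.mul_apply] at this
    simpa only [Matrix.mul_apply, Finset.sum_mul] using this
  have hquad : ∀ x y u v : ℂ, ∑ a, ∑ b, g⁻¹ b a * (x * g i b + y * g k b) * (u * g a j + v * g a l) =
      x * u * g i j + x * v * g i l + y * u * g k j + y * v * g k l := by
    intro x y u v
    rw [← hS i j, ← hS i l, ← hS k j, ← hS k l]
    simp only [Finset.mul_sum, ← Finset.sum_add_distrib]
    exact Finset.sum_congr rfl fun a _ => Finset.sum_congr rfl fun b _ => by ring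
  set h : ℂ := (diagonalQuadratic c₀ c p : ℂ)⁻¹ with hh
  have hsum : ∑ a, ∑ b, g⁻¹ b a * wirtinger k (fun z => fubiniStudy c₀ c z i b) p *
      wirtingerBar l (fun z => fubiniStudy c₀ c z a j) p =
      h ^ 2 * (c k * conj (p k) * (c l * p l) * g i j + c k * conj (p k) * (c j * p j) * g i l +
        c i * conj (p i) * (c l * p l) * g k j + c i * conj (p i) * (c j * p j) * g k l) := by
    rw [← hquad, Finset.mul_sum]
    refine Finset.sum_congr rfl fun a _ => ?_
    rw [Finset.mul_sum]
    refine Finset.sum_congr rfl fun b _ => ?_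
    rw [(hasWirtinger_fubiniStudy h₀ hc i b k p).wirtinger_eq,
      (hasWirtingerBar_fubiniStudy h₀ hc a j l p).wirtingerBar_eq]
    ring
  have hδ : ∀ l, (if l = k then (1 : ℂ) else 0) * c l * h =
      g k l + c k * conj (p k) * (c l * p l) * h ^ 2 := by
    intro l
    rw [hg, fubiniStudy, Matrix.of_apply, ← hh]
    by_cases hkl : k = l
    · subst hkl
      simp only [if_true]
      ring
    · simp only [hkl, Ne.symm hkl, if_false]
      ring
  rw [kahlerCurvature, hsum, hbar, h2]
  linear_combination g i j * hδ l + g i l * hδ j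

theorem holSectionalCurvature_fubiniStudy (h₀ : 0 < c₀) (hc : ∀ j, 0 < c j) (p : Fin n → ℂ)
    {X : Fin n → ℂ} (hX : X ≠ 0) : holSectionalCurvature (fubiniStudy c₀ c) p X = 2 := by
  have hQ := (fubiniStudy_quadraticForm_pos h₀ hc p hX).ne'
  rw [holSectionalCurvature, div_eq_iff (pow_ne_zero 2 hQ)]
  set Q : ℂ := ∑ i, ∑ j, fubiniStudy c₀ c p i j * X i * conj (X j) with hQdef
  have h1 : ∑ i, ∑ j, ∑ k, ∑ l, fubiniStudy c₀ c p i j * fubiniStudy c₀ c p k l *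
      X i * conj (X j) * X k * conj (X l) = Q ^ 2 := by
    rw [sq]
    nth_rewrite 1 [hQdef]
    simp only [Finset.sum_mul]
    refine Finset.sum_congr rfl fun i _ => Finset.sum_congr rfl fun j _ => ?_
    rw [hQdef, Finset.mul_sum]
    refine Finset.sum_congr rfl fun k _ => ?_
    rw [Finset.mul_sum]
    exact Finset.sum_congr rfl fun l _ => by ring
  have h2 : ∑ i, ∑ j, ∑ k, ∑ l, fubiniStudy c₀ c p k j * fubiniStudy c₀ c p i l *
      X i * conj (X j) * X k * conj (X l) = Q ^ 2 := by
    rw [← h1]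
    refine Finset.sum_congr rfl fun i _ => ?_
    -- Exchanging `j` and `l` carries the second curvature term to the first.
    have hsw : ∀ f : Fin n → Fin n → Fin n → ℂ, ∑ j, ∑ k, ∑ l, f j k l = ∑ l, ∑ k, ∑ j, f j k l := by
      intro f
      rw [Finset.sum_comm]
      simp_rw [Finset.sum_comm (f := fun j l => f j _ l)]
      rw [Finset.sum_comm]
    rw [hsw]
    exact Finset.sum_congr rfl fun l _ => Finset.sum_congr rfl fun k _ =>
      Finset.sum_congr rfl fun j _ => by ring
  simp only [kahlerCurvature_fubiniStudy h₀ hc, add_mul, Finset.sum_add_distrib]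
  rw [h1, h2]
  ring

end FubiniStudy

/-! ### Bergman metrics whose kernel is `c₀ + ∑ cⱼ |zⱼ|²` -/

section

variable {n : ℕ} {Ω : Opens (Fin n → ℂ)} {c₀ : ℝ} {c : Fin n → ℝ}

/-- Openness of `Ω` is essential: the kernels must agree near `p`, not only at `p`, for their
derivatives to agree. -/
theorem bergmanMetric_eq_fubiniStudy (h₀ : 0 < c₀) (hc : ∀ j, 0 < c j)
    (hK : ∀ p ∈ Ω, bergmanKernel Ω p = diagonalQuadratic c₀ c p) {p : Fin n → ℂ} (hp : p ∈ Ω) :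
    bergmanMetric Ω p = fubiniStudy c₀ c p := by
  ext i j
  rw [← wirtinger_wirtingerBar_log_diagonalQuadratic h₀ hc, bergmanMetric, Matrix.of_apply]
  refine wirtinger_congr ?_
  filter_upwards [Ω.isOpen.mem_nhds hp] with z hz
  refine wirtingerBar_congr ?_
  filter_upwards [Ω.isOpen.mem_nhds hz] with w hw
  rw [hK w hw]

theorem hasBergmanMetric_of_kernel_eq (h₀ : 0 < c₀) (hc : ∀ j, 0 < c j)
    (hK : ∀ p ∈ Ω, bergmanKernel Ω p = diagonalQuadratic c₀ c p) : HasBergmanMetric Ω where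
  smooth := contDiff_diagonalQuadratic.contDiffOn.congr hK
  pos p hp := by
    rw [hK p hp]
    exact diagonalQuadratic_pos h₀ hc p
  posDef p hp := by
    rw [bergmanMetric_eq_fubiniStudy h₀ hc hK hp]
    exact fubiniStudy_posDef h₀ hc p

theorem holSectionalCurvature_bergmanMetric_of_kernel_eq (h₀ : 0 < c₀) (hc : ∀ j, 0 < c j)
    (hK : ∀ p ∈ Ω, bergmanKernel Ω p = diagonalQuadratic c₀ c p) {p : Fin n → ℂ} (hp : p ∈ Ω)
    {X : Fin n → ℂ} (hX : X ≠ 0) : holSectionalCurvature (bergmanMetric Ω) p X = 2 := by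
  rw [← holSectionalCurvature_fubiniStudy h₀ hc p hX]
  have he : bergmanMetric Ω =ᶠ[nhds p] fubiniStudy c₀ c := by
    filter_upwards [Ω.isOpen.mem_nhds hp] with z hz
    exact bergmanMetric_eq_fubiniStudy h₀ hc hK hz
  have he' : ∀ i j, (fun z => bergmanMetric Ω z i j) =ᶠ[nhds p] fun z => fubiniStudy c₀ c z i j :=
    fun i j => he.fun_comp fun M => M i j
  have hR : ∀ i j k l, kahlerCurvature (bergmanMetric Ω) p i j k l =
      kahlerCurvature (fubiniStudy c₀ c) p i j k l := by
    intro i j k l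
    have h1 : wirtinger k (wirtingerBar l fun z => bergmanMetric Ω z i j) p =
        wirtinger k (wirtingerBar l fun z => fubiniStudy c₀ c z i j) p :=
      wirtinger_congr ((he' i j).eventually_nhds.mono fun z hz => wirtingerBar_congr hz)
    simp only [kahlerCurvature, h1, he.eq_of_nhds, wirtinger_congr (he' _ _),
      wirtingerBar_congr (he' _ _)]
  simp only [holSectionalCurvature, hR, he.eq_of_nhds]

end

end

theorem mainTheorem6 (α : ℝ) (h₂ : 2 < α) (h₃ : α < 3) :
    (IsReinhardt (reinhardtD α) ∧ IsConnected (reinhardtD α : Set (Fin 2 → ℂ)) ∧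
      ¬ Bornology.IsBounded (reinhardtD α : Set (Fin 2 → ℂ))) ∧
    bergmanSpace (reinhardtD α) =
      Submodule.span ℂ {fun _ => 1, fun p => p.1 0, fun p => p.1 1} ∧
    HasBergmanMetric (reinhardtD α) ∧
    ∀ p ∈ reinhardtD α, ∀ X : Fin 2 → ℂ, X ≠ 0 →
      holSectionalCurvature (bergmanMetric (reinhardtD α)) p X = 2 := by
  obtain ⟨c₀, c, h₀, hc, hK⟩ := exists_bergmanKernel_reinhardtD h₂ h₃
  exact ⟨⟨isReinhardt_reinhardtD α, isConnected_reinhardtD (by linarith),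
    not_isBounded_reinhardtD α⟩, bergmanSpace_reinhardtD h₂ h₃,
    hasBergmanMetric_of_kernel_eq h₀ hc hK,
    fun p hp X hX => holSectionalCurvature_bergmanMetric_of_kernel_eq h₀ hc hK hp hX⟩
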